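/- Let $\Omega\subset\mathbb R^3$ be an open neighborhood of $0$, and let $$\square=\sum_{i,j=1}^3 g_{ij}(x)\,\partial_{x_i}\partial_{x_j}+\sum_{i=1}^3 b_i(x)\,\partial_{x_i}+c(x)$$ be a second order differential operator with $C^\infty$ coefficients on $\Omega$ and real $g_{ij}$, acting on real- or complex-valued functions ($b_i$, $c$ take values in the same field). Suppose that $\square$ is strictly hyperbolic with respect to a time function $t\in C^\infty(\Omega;\mathbb R)$: writing $p(x,\xi)=\sum_{i,j} g_{ij}(x)\xi_i\xi_j$, for every $x\in\Omega$ one has $p(x,dt(x))\neq 0$, and for every covector $\xi$ not proportional to $dt(x)$ the equation $p(x,\xi+\tau\,dt(x))=0$ has two distinct real roots $\tau$. Let $\Sigma_1,\Sigma_2,\Sigma_3\subset\Omega$ be $C^\infty$ embedded hypersurfaces, closed in $\Omega$ and characteristic for $\square$ (that is, $p$ vanishes on the normal covectors of $\Sigma_j$), such that $\Sigma_1\cap\Sigma_2\cap\Sigma_3=\{0\}$ and the normals to $\Sigma_1,\Sigma_2,\Sigma_3$ at $0$ are linearly independent. Then there exist $C^\infty$ local coordinates $y=(y_1,y_2,y_3)$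 on an open neighborhood $U\subset\Omega$ of $0$ such that $\Sigma_j\cap U=\{y_j=0\}$ for $j=1,2,3$, and such that in these coordinates $$\square=a_{12}(y)\,\partial_{y_1}\partial_{y_2}+a_{13}(y)\,\partial_{y_1}\partial_{y_3}+a_{23}(y)\,\partial_{y_2}\partial_{y_3}+\mathcal L,$$ where $a_{12},a_{13},a_{23}$ are real-valued $C^\infty$ functions and $\mathcal L$ is a linear differential operator of order at most one (a zeroth order term is allowed) with $C^\infty$ coefficients. -/

import Mathlib

open scoped ContDiff

noncomputable section

/-- Three-dimensional Euclidean space. -/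
abbrev R3 : Type := EuclideanSpace ℝ (Fin 3)

/-- The partial derivative `∂ᵢ u` of a function on (an open subset of) `ℝ³`. -/
def pd {F : Type*} [NormedAddCommGroup F] [NormedSpace ℝ F] (i : Fin 3) (u : R3 → F) : R3 → F :=
  fun x => fderiv ℝ u x (EuclideanSpace.single i 1)

/-- The coefficients of a linear differential operator `∑ᵢ bᵢ ∂ᵢ + c` of order one. -/
structure FirstOrderOp (𝕜 : Type*) [RCLike 𝕜] where
  b : Fin 3 → R3 → 𝕜
  c : R3 → 𝕜

namespace FirstOrderOp

variable {𝕜 : Type*} [RCLike 𝕜]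

/-- The action of `∑ᵢ bᵢ ∂ᵢ + c` on a function. -/
def apply (L : FirstOrderOp 𝕜) (u : R3 → 𝕜) (x : R3) : 𝕜 :=
  ∑ i, L.b i x * pd i u x + L.c x * u x

/-- The coefficients are smooth on `U`. -/
def SmoothOn (L : FirstOrderOp 𝕜) (U : Set R3) : Prop :=
  (∀ i, ContDiffOn ℝ ∞ (L.b i) U) ∧ ContDiffOn ℝ ∞ L.c U

end FirstOrderOp

/-- The coefficients of a linear differential operator
`∑ᵢⱼ gᵢⱼ ∂ᵢ∂ⱼ + ∑ᵢ bᵢ ∂ᵢ + c` of order two with real principal part. -/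
structure SecondOrderOp (𝕜 : Type*) [RCLike 𝕜] where
  g : Fin 3 → Fin 3 → R3 → ℝ
  lower : FirstOrderOp 𝕜

namespace SecondOrderOp

variable {𝕜 : Type*} [RCLike 𝕜]

/-- The action of `∑ᵢⱼ gᵢⱼ ∂ᵢ∂ⱼ + ∑ᵢ bᵢ ∂ᵢ + c` on a function. -/
def apply (P : SecondOrderOp 𝕜) (u : R3 → 𝕜) (x : R3) : 𝕜 :=
  ∑ i, ∑ j, P.g i j x • pd i (pd j u) x + P.lower.apply u x

/-- The coefficients are smooth on `U`. -/
def SmoothOn (P : SecondOrderOp 𝕜) (U : Set R3) : Prop :=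
  (∀ i j, ContDiffOn ℝ ∞ (P.g i j) U) ∧ P.lower.SmoothOn U

/-- The principal symbol `p(x, ξ) = ∑ᵢⱼ gᵢⱼ(x) ξᵢ ξⱼ` (without the customary factor `i² = -1`)
at the covector `ξ`, whose components are `ξᵢ = ξ(eᵢ)`. -/
def symbol (P : SecondOrderOp 𝕜) (x : R3) (ξ : R3 →L[ℝ] ℝ) : ℝ :=
  ∑ i, ∑ j, P.g i j x * ξ (EuclideanSpace.single i 1) * ξ (EuclideanSpace.single j 1)

/-- `P` is strictly hyperbolic in `Ω` with respect to the level surfaces of `t` (so that `t` is a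
time function for `P`): at every point of `Ω` the covector `dt` is noncharacteristic, and for each
covector `ξ` that is not a multiple of `dt` the quadratic equation `p(x, ξ + τ dt) = 0` has two
distinct real roots `τ`. -/
def StrictlyHyperbolicOn (P : SecondOrderOp 𝕜) (Ω : Set R3) (t : R3 → ℝ) : Prop :=
  ∀ x ∈ Ω, P.symbol x (fderiv ℝ t x) ≠ 0 ∧
    ∀ ξ : R3 →L[ℝ] ℝ, (¬ ∃ r : ℝ, ξ = r • fderiv ℝ t x) →
      ∃ τ₁ τ₂ : ℝ, τ₁ ≠ τ₂ ∧
        P.symbol x (ξ + τ₁ • fderiv ℝ t x) = 0 ∧ P.symbol x (ξ + τ₂ • fderiv ℝ t x) = 0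

end SecondOrderOp

/-- `φ` is a smooth defining function of `S` in the open set `U`: it has no critical points in `U`
and `S ∩ U` is its zero set. -/
structure IsDefiningFunction (S U : Set R3) (φ : R3 → ℝ) : Prop where
  isOpen : IsOpen U
  smooth : ContDiffOn ℝ ∞ φ U
  fderiv_ne_zero : ∀ x ∈ U, fderiv ℝ φ x ≠ 0
  mem_iff : ∀ x ∈ U, x ∈ S ↔ φ x = 0

/-- `S` is a smooth (embedded) hypersurface contained in, and relatively closed in, `Ω`. -/
structure IsClosedHypersurface (Ω S : Set R3) : Prop where
  subset : S ⊆ Ω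
  closed : ∃ C : Set R3, IsClosed C ∧ S = C ∩ Ω
  exists_defining : ∀ x ∈ S, ∃ (U : Set R3) (φ : R3 → ℝ), x ∈ U ∧ IsDefiningFunction S U φ

/-- `ξ` is a (nonzero) normal covector of the hypersurface `S` at `x`, that is, the differential at
`x` of a local defining function. -/
def IsNormalCovector (S : Set R3) (x : R3) (ξ : R3 →L[ℝ] ℝ) : Prop :=
  ∃ (U : Set R3) (φ : R3 → ℝ), x ∈ U ∧ IsDefiningFunction S U φ ∧ ξ = fderiv ℝ φ x

/-- `S` is characteristic for `P`: the principal symbol vanishes on the normal covectors of `S`. -/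
def IsCharacteristic {𝕜 : Type*} [RCLike 𝕜] (P : SecondOrderOp 𝕜) (S : Set R3) : Prop :=
  ∀ x ∈ S, ∀ ξ : R3 →L[ℝ] ℝ, IsNormalCovector S x ξ → P.symbol x ξ = 0

end

/-!
The coordinates are solutions of the eikonal equation. If `y₁, y₂, y₃` satisfy `p(x, dyₖ) = 0`, where
`p` is the principal symbol, then the coefficients of `∂²/∂yₖ²` in these coordinates, which are
`p(x, dyₖ)`, vanish, and what remains of the principal part are the mixed derivatives
(`SecondOrderOp.apply_comp`). So it suffices to find, near the origin, for each characteristic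
surface `ψ = 0` a solution `φ` of the eikonal equation with `dφ(0) = dψ(0)` and the same zero set
(`exists_eikonal_defining_function`). The independence of the normals then makes the three solutions
a coordinate system, by the inverse function theorem.

The eikonal equation is solved by the method of characteristics (`exists_eikonal_solution`).
Hyperbolicity enters only here: it guarantees that the characteristic direction `n` belonging to the
null covector `dψ(0)` is not zero. On a hyperplane transversal to `n` take `φ = ψ`, and choose the
covector `Ξ` there as the null covector near `dψ` with the same restriction to the hyperplane. Along the
flow `(Ψ, Ξ)` of the Hamiltonian field, `p` is conserved, hence zero, and therefore the
pull-back of `Ξ` by `Ψ` does not change either (`exists_characteristics`). So transporting the values of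
`ψ` along the characteristics gives a `φ` with `dφ = Ξ`, which is null.

The surface `ψ = 0` is in the zero set of `φ` because there is a vector field `X`, nonzero and
transversal to the hyperplane at the origin, with `X ψ = 0` everywhere and `X φ = 0` on the surface: a
combination of the gradients of `φ` and `ψ` with respect to `p` and of a constant field. The
integral curves of `X` connect the surface to its intersection with the hyperplane, where `φ = ψ`
(`eventually_eikonal_solution_eq_zero`). As the two differentials agree at the origin, the
zero sets coincide (`eventually_eq_zero_of_forall_zero_imp`).

Both flows need smooth dependence of solutions of ordinary differential equations on the initial data
(`exists_smoothNear_solution`). It follows from the inverse function theorem in the Banach space of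
continuous curves, since composition with a smooth function is a smooth operator there
(`ContinuousMap.contDiff_comp_left`).
-/

open Filter Topology Set

/-! ### Functions that are smooth near a point -/

/-- `f` is smooth on a neighbourhood of `a`. This is stronger than `ContDiffAt ℝ ∞ f a`, which
provides a neighbourhood for every finite order of differentiability, but not one for all. -/
def SmoothNear {E F : Type*} [NormedAddCommGroup E] [NormedSpace ℝ E]
    [NormedAddCommGroup F] [NormedSpace ℝ F] (f : E → F) (a : E) : Prop :=
  ∀ᶠ x in 𝓝 a, ContDiffAt ℝ ∞ f x

section SmoothNear

variable {E F Z : Type*} [NormedAddCommGroup E] [NormedSpace ℝ E]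
  [NormedAddCommGroup F] [NormedSpace ℝ F] [NormedAddCommGroup Z] [NormedSpace ℝ Z]

theorem ContDiff.smoothNear {f : E → F} (h : ContDiff ℝ ∞ f) (a : E) : SmoothNear f a :=
  Eventually.of_forall fun _ => h.contDiffAt

theorem ContDiffOn.smoothNear {f : E → F} {U : Set E} (h : ContDiffOn ℝ ∞ f U) (hU : IsOpen U)
    {a : E} (ha : a ∈ U) : SmoothNear f a := by
  filter_upwards [hU.mem_nhds ha] with x hx using h.contDiffAt (hU.mem_nhds hx)

namespace SmoothNear

theorem contDiffAt {f : E → F} {a : E} (h : SmoothNear f a) : ContDiffAt ℝ ∞ f a := h.self_of_nhds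

theorem continuousAt {f : E → F} {a : E} (h : SmoothNear f a) : ContinuousAt f a :=
  h.contDiffAt.continuousAt

theorem differentiableAt {f : E → F} {a : E} (h : SmoothNear f a) : DifferentiableAt ℝ f a :=
  h.contDiffAt.differentiableAt (by simp)

theorem eventually_differentiableAt {f : E → F} {a : E} (h : SmoothNear f a) :
    ∀ᶠ x in 𝓝 a, DifferentiableAt ℝ f x :=
  h.mono fun _ hx => hx.differentiableAt (by simp)

theorem comp {g : F → Z} {f : E → F} {a : E} (hg : SmoothNear g (f a)) (hf : SmoothNear f a) :
    SmoothNear (fun x => g (f x)) a := by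
  filter_upwards [hf, hf.continuousAt.eventually hg] with x h1 h2 using h2.comp x h1

theorem comp_of_eq {g : F → Z} {f : E → F} {a : E} {b : F} (hg : SmoothNear g b)
    (hf : SmoothNear f a) (h : f a = b) : SmoothNear (fun x => g (f x)) a := by
  subst h; exact hg.comp hf

theorem prodMk {f : E → F} {g : E → Z} {a : E} (hf : SmoothNear f a) (hg : SmoothNear g a) :
    SmoothNear (fun x => (f x, g x)) a := by
  filter_upwards [hf, hg] with x h1 h2 using h1.prodMk h2

theorem smoothNear_fderiv {f : E → F} {a : E} (h : SmoothNear f a) : SmoothNear (fderiv ℝ f) a := by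
  filter_upwards [h] with x hx using hx.fderiv_right (by simp)

end SmoothNear

/-- The inverse function theorem for functions that are smooth near a point: the local inverse is
smooth on its whole domain. -/
theorem SmoothNear.exists_openPartialHomeomorph [CompleteSpace E] {f : E → F} {a : E}
    (hf : SmoothNear f a) (f' : E ≃L[ℝ] F) (hf' : HasFDerivAt f (f' : E →L[ℝ] F) a)
    {p : E → Prop} (hp : ∀ᶠ x in 𝓝 a, p x) :
    ∃ e : OpenPartialHomeomorph E F, (e : E → F) = f ∧ a ∈ e.source ∧
      (∀ x ∈ e.source, ContDiffAt ℝ ∞ f x ∧ p x) ∧ ∀ y ∈ e.target, ContDiffAt ℝ ∞ e.symm y := by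
  have hinv : ∀ᶠ x in 𝓝 a, fderiv ℝ f x ∈ range ((↑) : (E ≃L[ℝ] F) → E →L[ℝ] F) := by
    have h1 := f'.nhds
    rw [← hf'.fderiv] at h1
    exact hf.smoothNear_fderiv.continuousAt h1
  obtain ⟨U, hU, hUo, haU⟩ := eventually_nhds_iff.1 (hf.and (hp.and hinv))
  let e₀ := hf.contDiffAt.toOpenPartialHomeomorph f hf' (by simp)
  let e := e₀.restrOpen U hUo
  have hsource : ∀ x ∈ e.source, x ∈ U := fun x hx => hx.2
  refine ⟨e, rfl, ⟨?_, haU⟩, fun x hx => ⟨(hU x (hsource x hx)).1, (hU x (hsource x hx)).2.1⟩, ?_⟩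
  · exact hf.contDiffAt.mem_toOpenPartialHomeomorph_source hf' (by simp)
  · intro y hy
    have hx := hU _ (hsource _ (e.map_target hy))
    obtain ⟨g, hg⟩ := hx.2.2
    refine e.contDiffAt_symm (f₀' := g) hy ?_ hx.1
    rw [hg]
    exact (hx.1.differentiableAt (by simp)).hasFDerivAt

/-- A function that is smooth near a point agrees near it with a function that is smooth
everywhere. -/
theorem SmoothNear.exists_contDiff [FiniteDimensional ℝ E] {f : E → F} {a : E}
    (hf : SmoothNear f a) : ∃ g : E → F, ContDiff ℝ ∞ g ∧ g =ᶠ[𝓝 a] f := by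
  obtain ⟨r, hr, hball⟩ := Metric.eventually_nhds_iff_ball.1 hf
  let b : ContDiffBump a := ⟨r / 4, r / 2, by positivity, by linarith⟩
  refine ⟨fun x => b x • f x, ?_, ?_⟩
  · rw [contDiff_iff_contDiffAt]
    intro x
    by_cases hx : x ∈ Metric.ball a r
    · exact b.contDiff.contDiffAt.smul (hball x hx)
    · have : (fun y => b y • f y) =ᶠ[𝓝 x] fun _ => 0 := by
        have hmem : (Metric.closedBall a (r / 2))ᶜ ∈ 𝓝 x := by
          refine Metric.isClosed_closedBall.isOpen_compl.mem_nhds ?_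
          simp only [mem_compl_iff, Metric.mem_closedBall, Metric.mem_ball, not_lt] at hx ⊢
          linarith
        filter_upwards [hmem] with y hy
        simp only [mem_compl_iff, Metric.mem_closedBall, not_le] at hy
        rw [b.zero_of_le_dist hy.le, zero_smul]
      exact contDiffAt_const.congr_of_eventuallyEq this
  · filter_upwards [b.eventuallyEq_one] with x hx
    simp [hx]

end SmoothNear

/-! ### Composition with a smooth function as an operator between spaces of continuous functions -/

section Nemytskii

universe u

variable {K : Type*} [TopologicalSpace K] [CompactSpace K]

/-- The pointwise application of a continuous family of operators to a continuous function, as a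
bounded bilinear map. -/
noncomputable def ContinuousMap.pointwiseApply (K : Type*) [TopologicalSpace K] [CompactSpace K]
    (Z F : Type*) [NormedAddCommGroup Z] [NormedSpace ℝ Z] [NormedAddCommGroup F]
    [NormedSpace ℝ F] : C(K, Z →L[ℝ] F) →L[ℝ] C(K, Z) →L[ℝ] C(K, F) :=
  LinearMap.mkContinuous₂
    (LinearMap.mk₂ ℝ
      (fun (A : C(K, Z →L[ℝ] F)) (γ : C(K, Z)) => (⟨fun k => A k (γ k), by fun_prop⟩ : C(K, F)))
      (fun A B γ => by ext; simp) (fun c A γ => by ext; simp)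
      (fun A γ δ => by ext; simp) (fun c A γ => by ext; simp)) 1 (by
    intro A γ
    rw [ContinuousMap.norm_le _ (by positivity)]
    intro k
    rw [one_mul]
    exact (A k).le_of_opNorm_le_of_le (A.norm_coe_le_norm k) (γ.norm_coe_le_norm k))

@[simp] theorem ContinuousMap.pointwiseApply_apply {Z F : Type*} [NormedAddCommGroup Z]
    [NormedSpace ℝ Z] [NormedAddCommGroup F] [NormedSpace ℝ F] (A : C(K, Z →L[ℝ] F)) (γ : C(K, Z))
    (k : K) : ContinuousMap.pointwiseApply K Z F A γ k = A k (γ k) := rfl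

theorem ContinuousMap.hasFDerivAt_comp_left {Z F : Type*} [NormedAddCommGroup Z]
    [NormedSpace ℝ Z] [NormedAddCommGroup F] [NormedSpace ℝ F] (H : C(Z, F)) (H' : C(Z, Z →L[ℝ] F))
    (hH : ∀ z, HasFDerivAt H (H' z) z) (γ : C(K, Z)) :
    HasFDerivAt (fun γ : C(K, Z) => H.comp γ)
      (ContinuousMap.pointwiseApply K Z F (H'.comp γ)) γ := by
  rw [hasFDerivAt_iff_isLittleO_nhds_zero, Asymptotics.isLittleO_iff]
  intro ε hε
  have hunif : {p : Z × Z | p.1 ∈ range γ → (H' p.1, H' p.2) ∈ {q | dist q.1 q.2 < ε}}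
      ∈ uniformity Z :=
    (isCompact_range γ.continuous).uniformContinuousAt_of_continuousAt _
      (fun z _ => H'.continuous.continuousAt) (Metric.dist_mem_uniformity hε)
  obtain ⟨δ, hδ, hδ'⟩ := Metric.mem_uniformity_dist.1 hunif
  filter_upwards [Metric.ball_mem_nhds (0 : C(K, Z)) hδ] with h hh
  rw [mem_ball_zero_iff] at hh
  rw [ContinuousMap.norm_le _ (by positivity)]
  intro k
  have hk : ‖h k‖ < δ := (h.norm_coe_le_norm k).trans_lt hh
  have hmv := (convex_ball (γ k) δ).norm_image_sub_le_of_norm_hasFDerivWithin_le'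
    (f := H) (f' := fun z => H' z) (φ := H' (γ k)) (C := ε) (x := γ k) (y := γ k + h k)
    (fun z _ => (hH z).hasFDerivWithinAt)
    (fun z hz => by
      have := hδ' (a := γ k) (b := z) (by rw [dist_comm]; exact hz) ⟨k, rfl⟩
      rw [← dist_eq_norm, dist_comm]
      exact le_of_lt this)
    (Metric.mem_ball_self hδ) (by simpa using hk)
  simp only [add_sub_cancel_left] at hmv
  refine le_trans ?_ (hmv.trans (mul_le_mul_of_nonneg_left (h.norm_coe_le_norm k) hε.le))
  rfl

/-- The derivative of the operator is again of this form, with `H'` in place of `H`; this is why `Z` and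
`F` live in the same universe, which then also contains the target `Z →L[ℝ] F` of `H'`. -/
theorem ContinuousMap.contDiff_nat_comp_left (n : ℕ) {Z F : Type u}
    [NormedAddCommGroup Z] [NormedSpace ℝ Z] [NormedAddCommGroup F] [NormedSpace ℝ F] (H : C(Z, F))
    (hH : ContDiff ℝ n H) : ContDiff ℝ n (fun γ : C(K, Z) => H.comp γ) := by
  induction n generalizing F with
  | zero => exact contDiff_zero.2 (ContinuousMap.continuous_postcomp H)
  | succ n ih =>
    obtain ⟨H', hH', hd⟩ := contDiff_succ_iff_hasFDerivAt.1 hH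
    refine contDiff_succ_iff_hasFDerivAt.2 ⟨_, ?_,
      ContinuousMap.hasFDerivAt_comp_left H ⟨H', hH'.continuous⟩ hd⟩
    exact (ContinuousMap.pointwiseApply K Z F).contDiff.comp (ih ⟨H', hH'.continuous⟩ hH')

theorem ContinuousMap.contDiff_comp_left {Z F : Type u} [NormedAddCommGroup Z] [NormedSpace ℝ Z]
    [NormedAddCommGroup F] [NormedSpace ℝ F] (H : C(Z, F)) (hH : ContDiff ℝ ∞ H) :
    ContDiff ℝ ∞ (fun γ : C(K, Z) => H.comp γ) :=
  contDiff_infty.2 fun n => ContinuousMap.contDiff_nat_comp_left n H (contDiff_infty.1 hH n)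

end Nemytskii

/-! ### Smooth dependence of solutions of ordinary differential equations on initial data -/

section Flow

open MeasureTheory

/-- The operator `γ ↦ (t ↦ ∫₀ᵗ γ)` on continuous functions on the unit interval. -/
noncomputable def volterra (Z : Type*) [NormedAddCommGroup Z] [NormedSpace ℝ Z] :
    C(unitInterval, Z) →L[ℝ] C(unitInterval, Z) :=
  have hc (γ : C(unitInterval, Z)) : Continuous fun s : ℝ => γ (projIcc 0 1 zero_le_one s) :=
    γ.continuous.comp continuous_projIcc
  LinearMap.mkContinuous
    { toFun := fun γ => ⟨fun t => ∫ s in (0 : ℝ)..t, γ (projIcc 0 1 zero_le_one s),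
        (intervalIntegral.continuous_primitive (fun a b => (hc γ).intervalIntegrable a b) 0).comp
          continuous_subtype_val⟩
      map_add' := fun γ δ => by
        ext t
        exact intervalIntegral.integral_add ((hc γ).intervalIntegrable _ _)
          ((hc δ).intervalIntegrable _ _)
      map_smul' := fun c γ => by
        ext t
        exact intervalIntegral.integral_smul c _ } 1 (by
    intro γ
    rw [ContinuousMap.norm_le _ (by positivity)]
    intro t
    refine (intervalIntegral.norm_integral_le_of_norm_le_const
      fun s _ => γ.norm_coe_le_norm _).trans ?_
    rw [sub_zero, abs_of_nonneg t.2.1, one_mul]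
    exact mul_le_of_le_one_right (norm_nonneg _) t.2.2)

theorem volterra_apply {Z : Type*} [NormedAddCommGroup Z] [NormedSpace ℝ Z]
    (γ : C(unitInterval, Z)) (t : unitInterval) :
    volterra Z γ t = ∫ s in (0 : ℝ)..t, γ (projIcc 0 1 zero_le_one s) := rfl

/-- If `γ` solves the rescaled equation `γ' = a H(γ)`, then `t ↦ t H(γ(t))` solves the equation
obtained from it by differentiation with respect to `a`. -/
theorem volterra_linearized {Z : Type*} [NormedAddCommGroup Z] [NormedSpace ℝ Z] [CompleteSpace Z]
    (H : C(Z, Z)) (H' : C(Z, Z →L[ℝ] Z)) (hH : ∀ z, HasFDerivAt H (H' z) z)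
    {a : ℝ} {c : Z} {γ δ : C(unitInterval, Z)}
    (hγ : γ = ContinuousMap.const _ c + a • volterra Z (H.comp γ))
    (hδ : ∀ t, δ t = (t : ℝ) • H (γ t)) :
    δ = volterra Z (H.comp γ) +
      a • volterra Z (ContinuousMap.pointwiseApply unitInterval Z Z (H'.comp γ) δ) := by
  have hγc : Continuous fun s : ℝ => H (γ (projIcc 0 1 zero_le_one s)) :=
    H.continuous.comp (γ.continuous.comp continuous_projIcc)
  -- the solution, extended to all times
  let g : ℝ → Z := fun t => c + a • ∫ s in (0 : ℝ)..t, H (γ (projIcc 0 1 zero_le_one s))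
  have hg : ∀ t, HasDerivAt g (a • H (γ (projIcc 0 1 zero_le_one t))) t := fun t =>
    ((intervalIntegral.integral_hasDerivAt_right (hγc.intervalIntegrable _ _)
      (hγc.stronglyMeasurableAtFilter _ _) hγc.continuousAt).const_smul a).const_add c
  have hgγ : ∀ t (ht : t ∈ Icc (0 : ℝ) 1), g t = γ ⟨t, ht⟩ := by
    intro t ht
    conv_rhs => rw [hγ]
    rfl
  have hgc : Continuous g := continuous_iff_continuousAt.2 fun t => (hg t).continuousAt
  ext t
  rw [hδ t, ← hgγ _ t.2]
  simp only [ContinuousMap.add_apply, ContinuousMap.smul_apply, volterra_apply]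
  have hderiv : ∀ s : ℝ, HasDerivAt (fun s => s • H (g s))
      (s • H' (g s) (a • H (γ (projIcc 0 1 zero_le_one s))) + (1 : ℝ) • H (g s)) s := fun s =>
    (hasDerivAt_id s).smul ((hH _).comp_hasDerivAt s (hg s))
  have hcont : Continuous fun s : ℝ =>
      s • H' (g s) (a • H (γ (projIcc 0 1 zero_le_one s))) + (1 : ℝ) • H (g s) := by
    have := H'.continuous.comp hgc
    have := H.continuous.comp hgc
    fun_prop
  have hft := intervalIntegral.integral_eq_sub_of_hasDerivAt (a := 0) (b := t)
    (fun s _ => hderiv s) (hcont.intervalIntegrable _ _)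
  simp only [zero_smul, sub_zero] at hft
  rw [← hft, ← intervalIntegral.integral_smul, ← intervalIntegral.integral_add]
  · refine intervalIntegral.integral_congr fun s hs => ?_
    rw [uIcc_of_le t.2.1] at hs
    have hs' : s ∈ Icc (0 : ℝ) 1 := ⟨hs.1, hs.2.trans t.2.2⟩
    simp only [projIcc_of_mem _ hs', ContinuousMap.comp_apply,
      ContinuousMap.pointwiseApply_apply, hδ, hgγ _ hs', one_smul, map_smul]
    rw [add_comm, smul_comm]
  · exact hγc.intervalIntegrable _ _
  · refine Continuous.intervalIntegrable ?_ _ _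
    exact (((ContinuousMap.pointwiseApply unitInterval Z Z (H'.comp γ)) δ).continuous.comp
      continuous_projIcc).const_smul a

/-- The projection onto the hyperplane `ν = 0` along `n` (where `ν n = 1`). -/
noncomputable def projAlong {E : Type*} [NormedAddCommGroup E] [NormedSpace ℝ E]
    (ν : E →L[ℝ] ℝ) (n : E) : E →L[ℝ] E :=
  ContinuousLinearMap.id ℝ E - ν.smulRight n

section projAlong
variable {E : Type*} [NormedAddCommGroup E] [NormedSpace ℝ E]

theorem projAlong_apply (ν : E →L[ℝ] ℝ) (n x : E) : projAlong ν n x = x - ν x • n := rfl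

theorem projAlong_self {ν : E →L[ℝ] ℝ} {n : E} (h : ν n = 1) : projAlong ν n n = 0 := by
  simp [projAlong_apply, h]

theorem projAlong_of_eq_zero {ν : E →L[ℝ] ℝ} {n x : E} (h : ν x = 0) : projAlong ν n x = x := by
  simp [projAlong_apply, h]

theorem apply_projAlong {ν : E →L[ℝ] ℝ} {n : E} (h : ν n = 1) (x : E) :
    ν (projAlong ν n x) = 0 := by
  simp [projAlong_apply, h]

end projAlong

/-- Smooth solution of the initial value problem `∂ₙΦ = H(Φ)`, with `Φ` prescribed on the
hyperplane `ν = 0`. With `γ` the solution along the segment from the projection of `x` to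
`x`, rescaled to the unit interval, the problem becomes an equation in
`C([0, 1], Z)` depending smoothly on `x`, to which the inverse function theorem applies; the
derivative `∂ₙγ` is then identified by uniqueness for the linearized equation. -/
theorem exists_smoothNear_solution {E : Type*} {Z : Type*}
    [NormedAddCommGroup E] [NormedSpace ℝ E] [CompleteSpace E]
    [NormedAddCommGroup Z] [NormedSpace ℝ Z] [FiniteDimensional ℝ Z]
    {H : Z → Z} {ι : E → Z} {z₀ : Z} (hH : SmoothNear H z₀) (hι : SmoothNear ι 0) (hι0 : ι 0 = z₀)
    {ν : E →L[ℝ] ℝ} {n : E} (hn : ν n = 1) :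
    ∃ Φ : E → Z, SmoothNear Φ 0 ∧ (∀ᶠ x in 𝓝 0, fderiv ℝ Φ x n = H (Φ x)) ∧
      ∀ᶠ x in 𝓝 0, ν x = 0 → Φ x = ι x := by
  have : CompleteSpace Z := FiniteDimensional.complete ℝ Z
  obtain ⟨h, hh, hhH⟩ := hH.exists_contDiff
  let Hc : C(Z, Z) := ⟨h, hh.continuous⟩
  let Hc' : C(Z, Z →L[ℝ] Z) := ⟨fderiv ℝ h, hh.continuous_fderiv (by simp)⟩
  have hHc : ∀ z, HasFDerivAt Hc (Hc' z) z := fun z =>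
    (hh.differentiable (by simp) z).hasFDerivAt
  let W := C(unitInterval, Z)
  let constL : Z →L[ℝ] W := ContinuousLinearMap.const ℝ unitInterval
  have hconstL : ∀ z, constL z = ContinuousMap.const _ z := fun z => rfl
  let V : W →L[ℝ] W := volterra Z
  let N : W → W := fun γ => Hc.comp γ
  have hN : ContDiff ℝ ∞ N := ContinuousMap.contDiff_comp_left Hc hh
  let N' : W → W →L[ℝ] W := fun γ => ContinuousMap.pointwiseApply unitInterval Z Z (Hc'.comp γ)
  have hN' : ∀ γ, HasFDerivAt N (N' γ) γ := ContinuousMap.hasFDerivAt_comp_left Hc Hc' hHc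
  have hN'c : Continuous N' := (ContinuousMap.pointwiseApply unitInterval Z Z).continuous.comp
    (ContinuousMap.continuous_postcomp Hc')
  let π := projAlong ν n
  have hιπ : SmoothNear (fun x => ι (π x)) 0 :=
    hι.comp_of_eq (π.contDiff.smoothNear 0) (map_zero π)
  -- the integral equation is `γ = R (x, γ)`
  let R : E × W → W := fun q => constL (ι (π q.1)) + ν q.1 • V (N q.2)
  let a : E × W := (0, constL z₀)
  have hR : SmoothNear R a := by
    have h1 : SmoothNear (fun q : E × W => ι (π q.1)) a :=
      hιπ.comp_of_eq (contDiff_fst.smoothNear a) rfl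
    filter_upwards [h1] with q hq
    exact (constL.contDiff.contDiffAt.comp q hq).add
      ((ν.contDiff.comp contDiff_fst).smul
        (V.contDiff.comp (hN.comp contDiff_snd))).contDiffAt
  have hRd : ∀ x : E, DifferentiableAt ℝ (fun x => ι (π x)) x → ∀ γ : W,
      HasFDerivAt R ((constL ∘L fderiv ℝ (fun x => ι (π x)) x) ∘L ContinuousLinearMap.fst ℝ E W +
        (ν x • (V ∘L N' γ) ∘L ContinuousLinearMap.snd ℝ E W +
          (ν ∘L ContinuousLinearMap.fst ℝ E W).smulRight (V (N γ)))) (x, γ) := by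
    intro x hx γ
    have h1 : HasFDerivAt (fun q : E × W => constL (ι (π q.1))) _ (x, γ) :=
      constL.hasFDerivAt.comp (x, γ)
        (HasFDerivAt.comp (x, γ) (g := fun x => ι (π x)) hx.hasFDerivAt hasFDerivAt_fst)
    have h2 : HasFDerivAt (fun q : E × W => ν q.1) _ (x, γ) :=
      ν.hasFDerivAt.comp (x, γ) hasFDerivAt_fst
    have h3 : HasFDerivAt (fun q : E × W => V (N q.2)) _ (x, γ) :=
      V.hasFDerivAt.comp (x, γ) (HasFDerivAt.comp (x, γ) (g := N) (hN' γ) hasFDerivAt_snd)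
    exact h1.add (h2.smul h3)
  let A : E × W → E × W := fun q => (q.1, q.2 - R q)
  have hA : SmoothNear A a := by
    filter_upwards [hR] with q hq
    exact contDiffAt_fst.prodMk (contDiffAt_snd.sub hq)
  let T : E →L[ℝ] W := constL ∘L fderiv ℝ (fun x => ι (π x)) 0 + ν.smulRight (V (N (constL z₀)))
  have hA' : HasFDerivAt A (((ContinuousLinearEquiv.refl ℝ E).skewProd
      (ContinuousLinearEquiv.refl ℝ W) (-T) : (E × W) ≃L[ℝ] E × W) : E × W →L[ℝ] E × W) a := by
    have h1 : HasFDerivAt A _ a := hasFDerivAt_fst.prodMk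
      (hasFDerivAt_snd.sub (hRd 0 hιπ.differentiableAt (constL z₀)))
    refine h1.congr_fderiv ?_
    ext q <;> simp [T, sub_eq_add_neg]
  obtain ⟨e, heA, hae, -, hes⟩ := hA.exists_openPartialHomeomorph _ hA' (p := fun _ => True)
    (Eventually.of_forall fun _ => trivial)
  have hAa : e a = ((0 : E), (0 : W)) := by
    rw [heA]
    simp [A, R, a, π, hι0]
  let Γ : E → W := fun x => (e.symm (x, 0)).2
  have htarget : ∀ᶠ x : E in 𝓝 0, ((x, 0) : E × W) ∈ e.target := by
    have hc : ContinuousAt (fun x : E => ((x, 0) : E × W)) 0 := by fun_prop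
    refine hc (e.open_target.mem_nhds ?_)
    have h1 := e.map_source hae
    rwa [hAa] at h1
  have hΓ : SmoothNear Γ 0 := by
    filter_upwards [htarget] with x hx
    exact contDiffAt_snd.comp x ((hes _ hx).comp x (contDiffAt_id.prodMk contDiffAt_const))
  have hΓ0 : Γ 0 = constL z₀ := by
    change (e.symm (0, 0)).2 = _
    rw [← hAa, e.left_inv hae]
  have hΓeq : ∀ᶠ x in 𝓝 0, Γ x = R (x, Γ x) := by
    filter_upwards [htarget] with x hx
    have h1 := e.right_inv hx
    rw [heA] at h1
    simp only [A, Prod.mk.injEq] at h1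
    have h2 : e.symm (x, 0) = (x, Γ x) := Prod.ext h1.1 rfl
    have h3 := h1.2
    rw [h2] at h3
    exact sub_eq_zero.1 h3
  -- makes the linearized equation uniquely solvable
  have hcontr : ∀ᶠ x in 𝓝 0, ‖ν x • (V ∘L N' (Γ x))‖ < 1 := by
    have hc : ContinuousAt (fun x => ‖ν x • (V ∘L N' (Γ x))‖) 0 := by
      have h1 : ContinuousAt (fun x => N' (Γ x)) 0 := hN'c.continuousAt.comp hΓ.continuousAt
      exact (ν.continuous.continuousAt.smul (continuousAt_const.clm_comp h1)).norm
    refine hc.eventually_lt continuousAt_const ?_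
    have h0 : ν 0 • (V ∘L N' (Γ 0)) = 0 := by
      rw [map_zero]
      exact zero_smul ℝ (V ∘L N' (Γ 0))
    rw [h0]
    exact ContinuousLinearMap.opNorm_zero.trans_lt one_pos
  let ev : W →L[ℝ] Z := ContinuousMap.evalCLM ℝ (1 : unitInterval)
  let Φ : E → Z := fun x => ev (Γ x)
  have hΦ : SmoothNear Φ 0 := by
    filter_upwards [hΓ] with x hx using ev.contDiff.contDiffAt.comp x hx
  have hΦ0 : Φ 0 = z₀ := by
    change ev (Γ 0) = z₀
    rw [hΓ0]
    rfl
  refine ⟨Φ, hΦ, ?_, ?_⟩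
  · have hHΦ : ∀ᶠ x in 𝓝 0, h (Φ x) = H (Φ x) := by
      have := hΦ.continuousAt
      rw [ContinuousAt, hΦ0] at this
      exact this hhH
    filter_upwards [hHΦ, hcontr, hΓeq.eventually_nhds, hΓ, hιπ] with x hx1 hx2 hx3 hx4 hx5
    have hΓx := (hx4.differentiableAt (by simp)).hasFDerivAt
    let δ : W := fderiv ℝ Γ x n
    have hδ : δ = V (N (Γ x)) + ν x • V (N' (Γ x) δ) := by
      have h1 : HasFDerivAt (fun y => R (y, Γ y)) _ x :=
        (hRd x (hx5.differentiableAt (by simp)) (Γ x)).comp x ((hasFDerivAt_id x).prodMk hΓx)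
      have h2 := h1.congr_of_eventuallyEq hx3
      have h3 : fderiv ℝ (fun x => ι (π x)) x n = 0 := by
        -- the initial value does not change in the direction `n`
        have h4 : HasDerivAt (fun s : ℝ => ι (π (x + s • n)))
            (fderiv ℝ (fun x => ι (π x)) x n) 0 := by
          have h5 : HasDerivAt (fun s : ℝ => x + s • n) n 0 := by
            simpa using ((hasDerivAt_id (0 : ℝ)).smul_const n).const_add x
          refine HasFDerivAt.comp_hasDerivAt (x := (0 : ℝ)) (l := fun x => ι (π x)) ?_ h5
          simpa using (hx5.differentiableAt (by simp)).hasFDerivAt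
        have h5 : (fun s : ℝ => ι (π (x + s • n))) = fun _ => ι (π x) := by
          ext s
          simp [π, projAlong_self hn]
        rw [h5] at h4
        exact h4.unique (hasDerivAt_const _ _)
      have h4 := congrArg (fun l => l n) (hΓx.unique h2)
      simp only [ContinuousLinearMap.comp_apply, _root_.add_apply,
        ContinuousLinearMap.prod_apply, ContinuousLinearMap.coe_fst', ContinuousLinearMap.coe_snd',
        _root_.smul_apply, ContinuousLinearMap.smulRight_apply, h3, map_zero, zero_add,
        hn, one_smul, ContinuousLinearMap.coe_id', id_eq] at h4
      rw [add_comm] at h4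
      exact h4
    let δ' : W := ⟨fun t => (t : ℝ) • Hc (Γ x t), by fun_prop⟩
    have hδ' : δ' = V (N (Γ x)) + ν x • V (N' (Γ x) δ') :=
      volterra_linearized Hc Hc' hHc hx3.self_of_nhds fun t => rfl
    have hsub : δ - δ' = (ν x • (V ∘L N' (Γ x))) (δ - δ') := by
      conv_lhs => rw [hδ, hδ']
      simp only [_root_.smul_apply, ContinuousLinearMap.comp_apply, map_sub]
      abel
    have hzero : δ - δ' = 0 := by
      by_contra hne
      have hpos := norm_pos_iff.2 hne
      have := (ν x • (V ∘L N' (Γ x))).le_opNorm (δ - δ')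
      rw [← hsub] at this
      nlinarith
    have hΦx : fderiv ℝ Φ x n = ev δ := by
      have h1 : HasFDerivAt Φ (ev ∘L fderiv ℝ Γ x) x := ev.hasFDerivAt.comp x hΓx
      rw [h1.fderiv]
      rfl
    rw [hΦx, sub_eq_zero.1 hzero, ← hx1]
    change ((1 : unitInterval) : ℝ) • h (Γ x 1) = h (Γ x 1)
    simp
  · filter_upwards [hΓeq] with x hx hνx
    change ev (Γ x) = ι x
    rw [hx]
    simp only [R, hνx, π, projAlong_of_eq_zero, hconstL, zero_smul, add_zero]
    rfl

end Flow

/-! ### Functions along the lines transversal to a hyperplane -/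

section AlongLines

variable {E F : Type*} [NormedAddCommGroup E] [NormedSpace ℝ E]
  [NormedAddCommGroup F] [NormedSpace ℝ F] {ν : E →L[ℝ] ℝ} {n : E}

theorem eq_projAlong_of_fderiv_eq_zero {f : E → F} {x : E}
    (hf : ∀ z ∈ segment ℝ (projAlong ν n x) x, DifferentiableAt ℝ f z ∧ fderiv ℝ f z n = 0) :
    f x = f (projAlong ν n x) := by
  let l : ℝ → E := fun s => projAlong ν n x + s • (ν x • n)
  have hl : ∀ s, HasDerivAt l (ν x • n) s := fun s => by
    have h := ((hasDerivAt_id' s).smul_const (ν x • n)).const_add (projAlong ν n x)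
    rwa [one_smul] at h
  have hmem : ∀ s ∈ Icc (0 : ℝ) 1, l s ∈ segment ℝ (projAlong ν n x) x := fun s hs => by
    rw [segment_eq_image']
    refine ⟨s, hs, ?_⟩
    simp [l, projAlong_apply]
  have hd : ∀ s ∈ Icc (0 : ℝ) 1, HasDerivAt (fun s => f (l s)) 0 s := fun s hs => by
    obtain ⟨h1, h2⟩ := hf _ (hmem s hs)
    have h3 : HasDerivAt (fun s => f (l s)) (fderiv ℝ f (l s) (ν x • n)) s :=
      h1.hasFDerivAt.comp_hasDerivAt s (hl s)
    rwa [map_smul, h2, smul_zero] at h3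
  have := constant_of_has_deriv_right_zero (a := 0) (b := 1)
    (fun s hs => (hd s hs).continuousAt.continuousWithinAt)
    (fun s hs => (hd s (Ico_subset_Icc_self hs)).hasDerivWithinAt) 1 (by simp)
  simpa [l, projAlong_apply] using this

theorem eventually_forall_segment_projAlong {p : E → Prop} (hp : ∀ᶠ z in 𝓝 0, p z) :
    ∀ᶠ x in 𝓝 0, ∀ z ∈ segment ℝ (projAlong ν n x) x, p z := by
  obtain ⟨r, hr, hball⟩ := Metric.eventually_nhds_iff_ball.1 hp
  have h1 : ∀ᶠ x in 𝓝 0, projAlong ν n x ∈ Metric.ball (0 : E) r := by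
    refine (projAlong ν n).continuous.continuousAt ?_
    rw [map_zero]
    exact Metric.ball_mem_nhds 0 hr
  filter_upwards [h1, Metric.ball_mem_nhds 0 hr] with x hx1 hx2 z hz
  exact hball z ((convex_ball 0 r).segment_subset hx1 hx2 hz)

theorem eventually_projAlong {p : E → Prop} (hp : ∀ᶠ z in 𝓝 0, p z) :
    ∀ᶠ x in 𝓝 0, p (projAlong ν n x) := by
  filter_upwards [eventually_forall_segment_projAlong (ν := ν) (n := n) hp] with x hx
  exact hx _ (left_mem_segment _ _ _)

theorem eventually_eq_projAlong {f : E → F} (hf : ∀ᶠ z in 𝓝 0, DifferentiableAt ℝ f z)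
    (hf' : ∀ᶠ z in 𝓝 0, fderiv ℝ f z n = 0) : ∀ᶠ x in 𝓝 0, f x = f (projAlong ν n x) := by
  filter_upwards [eventually_forall_segment_projAlong (ν := ν) (n := n) (hf.and hf')] with x hx
  exact eq_projAlong_of_fderiv_eq_zero hx

/-- At a point of the hyperplane `ν = 0`, the derivative of a function is determined by the
restriction of the function to the hyperplane and by its derivative in the direction `n`. -/
theorem fderiv_eq_of_eq_on_hyperplane (hn : ν n = 1) {f g : E → F} {x : E} (hx : ν x = 0)
    (hfg : ∀ᶠ y in 𝓝 x, ν y = 0 → f y = g y) (hf : DifferentiableAt ℝ f x)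
    (hg : DifferentiableAt ℝ g x) (v : E) :
    fderiv ℝ f x v = fderiv ℝ g x (projAlong ν n v) + ν v • fderiv ℝ f x n := by
  have hkey : fderiv ℝ f x (projAlong ν n v) = fderiv ℝ g x (projAlong ν n v) := by
    have hl : HasDerivAt (fun s : ℝ => x + s • projAlong ν n v) (projAlong ν n v) 0 := by
      simpa using ((hasDerivAt_id (0 : ℝ)).smul_const (projAlong ν n v)).const_add x
    have h0 : x + (0 : ℝ) • projAlong ν n v = x := by simp
    have h1 : HasDerivAt (fun s : ℝ => f (x + s • projAlong ν n v))
        (fderiv ℝ f x (projAlong ν n v)) 0 :=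
      HasFDerivAt.comp_hasDerivAt (x := (0 : ℝ)) (l := f) (by rw [h0]; exact hf.hasFDerivAt) hl
    have h2 : HasDerivAt (fun s : ℝ => g (x + s • projAlong ν n v))
        (fderiv ℝ g x (projAlong ν n v)) 0 :=
      HasFDerivAt.comp_hasDerivAt (x := (0 : ℝ)) (l := g) (by rw [h0]; exact hg.hasFDerivAt) hl
    have hc : ContinuousAt (fun s : ℝ => x + s • projAlong ν n v) 0 := hl.continuousAt
    rw [ContinuousAt, h0] at hc
    refine h1.unique (h2.congr_of_eventuallyEq ?_)
    filter_upwards [hc hfg] with s hs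
    exact hs (by simp [hx, apply_projAlong hn])
  rw [← hkey, ← map_smul, ← map_add, projAlong_apply, sub_add_cancel]

end AlongLines

/-! ### The eikonal equation -/

section Eikonal

-- nested spaces of operators need deeper instance synthesis than the default
set_option maxSynthPendingDepth 3

variable {E : Type*} [NormedAddCommGroup E] [NormedSpace ℝ E]

/-- Correction of `dψ` by a multiple of `ν` to a null covector field: the multiple is the small root
of a quadratic equation, written with the square root in the denominator so that
a vanishing leading coefficient is harmless. -/
theorem exists_null_covector_field {G : E → (E →L[ℝ] ℝ) →L[ℝ] E} (hG : SmoothNear G 0)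
    (hsymm : ∀ᶠ x in 𝓝 0, ∀ ξ η : E →L[ℝ] ℝ, ξ (G x η) = η (G x ξ))
    {ζ : E → E →L[ℝ] ℝ} (hζ : SmoothNear ζ 0) (hnull : ζ 0 (G 0 (ζ 0)) = 0)
    {ν : E →L[ℝ] ℝ} (hν : 0 < ν (G 0 (ζ 0))) :
    ∃ r : E → ℝ, SmoothNear r 0 ∧ r 0 = 0 ∧
      ∀ᶠ x in 𝓝 0, (ζ x + r x • ν) (G x (ζ x + r x • ν)) = 0 := by
  let a : E → ℝ := fun x => ν (G x ν)
  let b : E → ℝ := fun x => ν (G x (ζ x))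
  let c : E → ℝ := fun x => ζ x (G x (ζ x))
  have ha : SmoothNear a 0 := by
    filter_upwards [hG] with x h1
    exact contDiffAt_const.clm_apply (h1.clm_apply contDiffAt_const)
  have hb : SmoothNear b 0 := by
    filter_upwards [hG, hζ] with x h1 h2
    exact contDiffAt_const.clm_apply (h1.clm_apply h2)
  have hc : SmoothNear c 0 := by
    filter_upwards [hG, hζ] with x h1 h2
    exact h2.clm_apply (h1.clm_apply h2)
  have hc0 : c 0 = 0 := hnull
  have hb0 : 0 < b 0 := hν
  have hD : ∀ᶠ x in 𝓝 0, 0 < b x ^ 2 - a x * c x := by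
    refine continuousAt_const.eventually_lt
      ((hb.continuousAt.pow 2).sub (ha.continuousAt.mul hc.continuousAt)) ?_
    rw [hc0, mul_zero, sub_zero]
    positivity
  have hbpos : ∀ᶠ x in 𝓝 0, 0 < b x := continuousAt_const.eventually_lt hb.continuousAt hb0
  refine ⟨fun x => -c x / (b x + √(b x ^ 2 - a x * c x)), ?_, by simp [hc0], ?_⟩
  · filter_upwards [ha, hb, hc, hD, hbpos] with x h1 h2 h3 h4 h5
    refine h3.neg.div (h2.add (((h2.pow 2).sub (h1.mul h3)).sqrt h4.ne')) ?_
    positivity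
  · filter_upwards [hD, hbpos, hsymm] with x h4 h5 h6
    have hs := Real.sq_sqrt h4.le
    set s := √(b x ^ 2 - a x * c x)
    have hs0 : 0 ≤ s := Real.sqrt_nonneg _
    have hbs : b x + s ≠ 0 := by positivity
    have hexp : ∀ r : ℝ, (ζ x + r • ν) (G x (ζ x + r • ν)) = c x + 2 * r * b x + r ^ 2 * a x := by
      intro r
      simp only [map_add, map_smul, _root_.add_apply, _root_.smul_apply, smul_eq_mul, a, b, c]
      rw [h6 (ζ x) ν]
      ring
    rw [hexp]
    field_simp
    linear_combination c x * hs

/-- The Hamiltonian vector field of `(x, ξ) ↦ ξ (G x ξ)`. -/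
noncomputable def hamiltonianField (G : E → (E →L[ℝ] ℝ) →L[ℝ] E) (z : E × (E →L[ℝ] ℝ)) :
    E × (E →L[ℝ] ℝ) :=
  ((2 : ℝ) • G z.1 z.2, -(z.2 ∘L (fderiv ℝ G z.1).flip z.2))

theorem SmoothNear.hamiltonianField {G : E → (E →L[ℝ] ℝ) →L[ℝ] E} {x : E} (hG : SmoothNear G x)
    (ξ : E →L[ℝ] ℝ) : SmoothNear (hamiltonianField G) (x, ξ) := by
  have h1 : SmoothNear (fun z : E × (E →L[ℝ] ℝ) => G z.1) (x, ξ) :=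
    hG.comp_of_eq (contDiff_fst.smoothNear _) rfl
  have h2 : SmoothNear (fun z : E × (E →L[ℝ] ℝ) => fderiv ℝ G z.1) (x, ξ) :=
    hG.smoothNear_fderiv.comp_of_eq (contDiff_fst.smoothNear _) rfl
  filter_upwards [h1, h2] with z hz1 hz2
  have hflip : ContDiffAt ℝ ∞ (fun z : E × (E →L[ℝ] ℝ) => (fderiv ℝ G z.1).flip) z :=
    (ContinuousLinearMap.flipₗᵢ ℝ E (E →L[ℝ] ℝ) E).contDiff.contDiffAt.comp z hz2
  exact (contDiffAt_const.smul (hz1.clm_apply contDiffAt_snd)).prodMk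
    (contDiffAt_snd.clm_comp (hflip.clm_apply contDiffAt_snd)).neg

variable [FiniteDimensional ℝ E]

/-- The method of characteristics, before the change of variables: `Ψ` consists of
characteristics issued from the hyperplane `ν = 0`, and `Ξ` is a null covector field along `Ψ` which
is the pull-back of the differential of the function `x ↦ ψ (projAlong ν n x)`. -/
theorem exists_characteristics {G : E → (E →L[ℝ] ℝ) →L[ℝ] E} (hG : SmoothNear G 0)
    (hsymm : ∀ᶠ x in 𝓝 0, ∀ ξ η : E →L[ℝ] ℝ, ξ (G x η) = η (G x ξ))
    {ψ : E → ℝ} (hψ : SmoothNear ψ 0) (hnull : fderiv ℝ ψ 0 (G 0 (fderiv ℝ ψ 0)) = 0)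
    {ν : E →L[ℝ] ℝ} {n : E} (hn : ν n = 1) (hnG : n = (2 : ℝ) • G 0 (fderiv ℝ ψ 0)) :
    ∃ (Ψ : E → E) (Ξ : E → E →L[ℝ] ℝ), SmoothNear Ψ 0 ∧ SmoothNear Ξ 0 ∧
      HasFDerivAt Ψ (ContinuousLinearMap.id ℝ E) 0 ∧ Ξ 0 = fderiv ℝ ψ 0 ∧
      (∀ᶠ x in 𝓝 0, ν x = 0 → Ψ x = x) ∧ (∀ᶠ x in 𝓝 0, Ξ x (G (Ψ x) (Ξ x)) = 0) ∧
      ∀ᶠ x in 𝓝 0, ∀ v, Ξ x (fderiv ℝ Ψ x v) =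
        fderiv ℝ ψ (projAlong ν n x) (projAlong ν n v) := by
  have hνpos : 0 < ν (G 0 (fderiv ℝ ψ 0)) := by
    have h1 := hn
    rw [hnG, map_smul, smul_eq_mul] at h1
    linarith
  obtain ⟨r, hr, hr0, hrnull⟩ := exists_null_covector_field hG hsymm hψ.smoothNear_fderiv hnull hνpos
  let ι₂ : E → E →L[ℝ] ℝ := fun x => fderiv ℝ ψ x + r x • ν
  have hι₂ : SmoothNear ι₂ 0 := by
    filter_upwards [hr, hψ.smoothNear_fderiv] with x h1 h2 using h2.add (h1.smul contDiffAt_const)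
  have hι₂0 : ι₂ 0 = fderiv ℝ ψ 0 := by simp [ι₂, hr0]
  obtain ⟨Φ, hΦ, hΦn, hΦι⟩ := exists_smoothNear_solution
    (hG.hamiltonianField (fderiv ℝ ψ 0)) (ι := fun x => (x, ι₂ x))
    ((contDiff_id.smoothNear 0).prodMk hι₂) (by simp [hι₂0]) hn
  let Ψ : E → E := fun x => (Φ x).1
  let Ξ : E → E →L[ℝ] ℝ := fun x => (Φ x).2
  have hΨ : SmoothNear Ψ 0 := by
    filter_upwards [hΦ] with x hx using contDiffAt_fst.comp x hx
  have hΞ : SmoothNear Ξ 0 := by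
    filter_upwards [hΦ] with x hx using contDiffAt_snd.comp x hx
  have hΨι : ∀ᶠ x in 𝓝 0, ν x = 0 → Ψ x = x := by
    filter_upwards [hΦι] with x hx h using congrArg Prod.fst (hx h)
  have hΞι : ∀ᶠ x in 𝓝 0, ν x = 0 → Ξ x = ι₂ x := by
    filter_upwards [hΦι] with x hx h using congrArg Prod.snd (hx h)
  have hΨ0 : Ψ 0 = 0 := hΨι.self_of_nhds (map_zero ν)
  have hΞ0 : Ξ 0 = fderiv ℝ ψ 0 := (hΞι.self_of_nhds (map_zero ν)).trans hι₂0
  have hΨn : ∀ᶠ x in 𝓝 0, fderiv ℝ Ψ x n = (2 : ℝ) • G (Ψ x) (Ξ x) := by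
    filter_upwards [hΦ.eventually_differentiableAt, hΦn] with x h1 h2
    rw [h1.hasFDerivAt.fst.fderiv]
    exact congrArg Prod.fst h2
  have hΞn : ∀ᶠ x in 𝓝 0, fderiv ℝ Ξ x n = -(Ξ x ∘L (fderiv ℝ G (Ψ x)).flip (Ξ x)) := by
    filter_upwards [hΦ.eventually_differentiableAt, hΦn] with x h1 h2
    rw [h1.hasFDerivAt.snd.fderiv]
    exact congrArg Prod.snd h2
  have hΨt : Tendsto Ψ (𝓝 0) (𝓝 0) := by simpa [ContinuousAt, hΨ0] using hΨ.continuousAt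
  have hGΨ : SmoothNear (fun x => G (Ψ x)) 0 := hG.comp_of_eq hΨ hΨ0
  have hGΨ' : ∀ᶠ x in 𝓝 0, ∀ v, fderiv ℝ (fun x => G (Ψ x)) x v =
      fderiv ℝ G (Ψ x) (fderiv ℝ Ψ x v) := by
    filter_upwards [hΨt hG.eventually_differentiableAt, hΨ.eventually_differentiableAt]
      with x h1 h2 v
    have h3 : HasFDerivAt (fun x => G (Ψ x)) _ x := h1.hasFDerivAt.comp x h2.hasFDerivAt
    rw [h3.fderiv]
    rfl
  have hsymmΨ : ∀ᶠ x in 𝓝 0, ∀ ξ η : E →L[ℝ] ℝ, ξ (G (Ψ x) η) = η (G (Ψ x) ξ) :=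
    hΨt hsymm
  -- the velocity of the characteristics and its derivative
  let w : E → E := fun x => G (Ψ x) (Ξ x)
  have hw : SmoothNear w 0 := by
    filter_upwards [hGΨ, hΞ] with x h1 h2 using h1.clm_apply h2
  have hw' : ∀ᶠ x in 𝓝 0, ∀ v, fderiv ℝ w x v =
      fderiv ℝ G (Ψ x) (fderiv ℝ Ψ x v) (Ξ x) + G (Ψ x) (fderiv ℝ Ξ x v) := by
    filter_upwards [hGΨ.eventually_differentiableAt, hΞ.eventually_differentiableAt, hGΨ']
      with x h1 h2 h3 v
    have h4 : HasFDerivAt w _ x := h1.hasFDerivAt.clm_apply h2.hasFDerivAt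
    rw [h4.fderiv, ← h3]
    simp [add_comm]
  -- the symbol along the characteristics and its derivative
  let q : E → ℝ := fun x => Ξ x (w x)
  have hq : SmoothNear q 0 := by
    filter_upwards [hw, hΞ] with x h1 h2 using h2.clm_apply h1
  have hq' : ∀ᶠ x in 𝓝 0, ∀ v, fderiv ℝ q x v =
      Ξ x (fderiv ℝ G (Ψ x) (fderiv ℝ Ψ x v) (Ξ x)) + 2 * fderiv ℝ Ξ x v (G (Ψ x) (Ξ x)) := by
    filter_upwards [hw.eventually_differentiableAt, hΞ.eventually_differentiableAt, hw', hsymmΨ]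
      with x h1 h2 h3 h4 v
    have h5 : HasFDerivAt q _ x := h2.hasFDerivAt.clm_apply h1.hasFDerivAt
    have h6 : fderiv ℝ q x v = Ξ x (fderiv ℝ w x v) + fderiv ℝ Ξ x v (w x) := by
      rw [h5.fderiv]
      simp
    rw [h6, h3, map_add, h4 (Ξ x) (fderiv ℝ Ξ x v)]
    ring
  have hqn : ∀ᶠ x in 𝓝 0, fderiv ℝ q x n = 0 := by
    filter_upwards [hq', hΨn, hΞn] with x h1 h2 h3
    rw [h1, h2, h3]
    simp
  have hqπ := eventually_eq_projAlong (ν := ν) hq.eventually_differentiableAt hqn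
  have hq0 : ∀ᶠ x in 𝓝 0, q x = 0 := by
    filter_upwards [hqπ, eventually_projAlong (ν := ν) (n := n) (hrnull.and (hΨι.and hΞι))]
      with x h1 ⟨h2, h3, h4⟩
    have h5 := apply_projAlong hn x
    rw [h1]
    simp only [q, w]
    rw [h3 h5, h4 h5]
    exact h2
  have hq0' : ∀ᶠ x in 𝓝 0, ∀ v, fderiv ℝ q x v = 0 := by
    filter_upwards [hq0.eventually_nhds] with x hx v
    have h1 : q =ᶠ[𝓝 x] fun _ => 0 := hx
    rw [h1.fderiv_eq]
    simp
  -- the pull-back of the covector field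
  let α : E → E →L[ℝ] ℝ := fun x => Ξ x ∘L fderiv ℝ Ψ x
  have hα : SmoothNear α 0 := by
    filter_upwards [hΞ, hΨ.smoothNear_fderiv] with x h1 h2 using h1.clm_comp h2
  have hαn : ∀ᶠ x in 𝓝 0, fderiv ℝ α x n = 0 := by
    filter_upwards [hΞ.eventually_differentiableAt, hΨ,
      hΨ.smoothNear_fderiv.eventually_differentiableAt, hw', hq', hq0', hΞn,
      hΨn.eventually_nhds, hw.eventually_differentiableAt, hsymmΨ]
      with x h1 h2 h3 h4 h5 h6 h7 h8 h9 h10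
    ext v
    have h11 : HasFDerivAt α _ x := h1.hasFDerivAt.clm_comp h3.hasFDerivAt
    have h12 : fderiv ℝ α x n v =
        Ξ x (fderiv ℝ (fderiv ℝ Ψ) x n v) + fderiv ℝ Ξ x n (fderiv ℝ Ψ x v) := by
      rw [h11.fderiv]
      simp
    have h13 : fderiv ℝ (fderiv ℝ Ψ) x n v = fderiv ℝ (fderiv ℝ Ψ) x v n :=
      (h2.isSymmSndFDerivAt (by simpa using ENat.LEInfty.out)).eq n v
    have h14 : fderiv ℝ (fderiv ℝ Ψ) x v n = (2 : ℝ) • fderiv ℝ w x v := by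
      have h15 : HasFDerivAt (fun y => fderiv ℝ Ψ y n) _ x :=
        h3.hasFDerivAt.clm_apply (hasFDerivAt_const n x)
      have h16 : HasFDerivAt (fun y => fderiv ℝ Ψ y n) _ x :=
        (h9.hasFDerivAt.const_smul (2 : ℝ)).congr_of_eventuallyEq h8
      have h17 := congrArg (fun l => l v) (h15.unique h16)
      simpa using h17
    have h18 := h5 v
    rw [h6] at h18
    rw [h12, h13, h14, h4, h7]
    simp only [map_smul, map_add, smul_eq_mul, _root_.neg_apply, ContinuousLinearMap.comp_apply,
      ContinuousLinearMap.flip_apply, _root_.zero_apply]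
    rw [h10 (Ξ x) (fderiv ℝ Ξ x v)]
    -- what is left is the derivative of the symbol in the direction `v`
    linear_combination -h18
  have hαπ := eventually_eq_projAlong (ν := ν) hα.eventually_differentiableAt hαn
  refine ⟨Ψ, Ξ, hΨ, hΞ, ?_, hΞ0, hΨι, hq0, ?_⟩
  · refine hΨ.differentiableAt.hasFDerivAt.congr_fderiv ?_
    ext v
    rw [fderiv_eq_of_eq_on_hyperplane hn (map_zero ν) hΨι hΨ.differentiableAt differentiableAt_fun_id,
      hΨn.self_of_nhds, hΨ0, hΞ0, ← hnG]
    simp [projAlong_apply]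
  · filter_upwards [hαπ, eventually_projAlong (ν := ν) (n := n) (hΨι.eventually_nhds.and
      (hΞι.and (hΨ.eventually_differentiableAt.and (hΨn.and hq0))))]
      with x h1 ⟨h2, h3, h4, h5, h6⟩ v
    have hνx := apply_projAlong hn x
    have h7 : Ξ x (fderiv ℝ Ψ x v) = α (projAlong ν n x) v := congrArg (fun l => l v) h1
    rw [h7]
    simp only [α, ContinuousLinearMap.comp_apply]
    rw [fderiv_eq_of_eq_on_hyperplane hn hνx h2 h4 differentiableAt_fun_id, h5]
    have h8 : Ξ (projAlong ν n x) (G (Ψ (projAlong ν n x)) (Ξ (projAlong ν n x))) = 0 := h6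
    rw [map_add, map_smul, map_smul, h8, h3 hνx]
    simp [ι₂, apply_projAlong hn]

/-- Solution of the eikonal equation `p(x, dφ) = 0`, where `p(x, ξ) = ξ (G x ξ)`, with the same
values on the hyperplane `ν = 0` and the same differential at the origin as a given function `ψ`. The
hyperplane has to be transversal to the characteristic direction `G 0 (dψ)` at the origin. -/
theorem exists_eikonal_solution {G : E → (E →L[ℝ] ℝ) →L[ℝ] E} (hG : SmoothNear G 0)
    (hsymm : ∀ᶠ x in 𝓝 0, ∀ ξ η : E →L[ℝ] ℝ, ξ (G x η) = η (G x ξ))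
    {ψ : E → ℝ} (hψ : SmoothNear ψ 0) (hnull : fderiv ℝ ψ 0 (G 0 (fderiv ℝ ψ 0)) = 0)
    {ν : E →L[ℝ] ℝ} {n : E} (hn : ν n = 1) (hnG : n = (2 : ℝ) • G 0 (fderiv ℝ ψ 0)) :
    ∃ φ : E → ℝ, SmoothNear φ 0 ∧ fderiv ℝ φ 0 = fderiv ℝ ψ 0 ∧
      (∀ᶠ x in 𝓝 0, ν x = 0 → φ x = ψ x) ∧
      ∀ᶠ x in 𝓝 0, fderiv ℝ φ x (G x (fderiv ℝ φ x)) = 0 := by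
  have : CompleteSpace E := FiniteDimensional.complete ℝ E
  obtain ⟨Ψ, Ξ, hΨ, hΞ, hΨ', hΞ0, hΨι, hq, hpull⟩ :=
    exists_characteristics hG hsymm hψ hnull hn hnG
  have hΨ0 : Ψ 0 = 0 := hΨι.self_of_nhds (map_zero ν)
  obtain ⟨e, he, h0e, hesource, hetarget⟩ := hΨ.exists_openPartialHomeomorph
    (ContinuousLinearEquiv.refl ℝ E) hΨ' (hpull.and (hq.and
      (eventually_projAlong (ν := ν) (n := n) hψ)))
  have he0 : e 0 = 0 := by rw [he, hΨ0]
  have h0t : (0 : E) ∈ e.target := by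
    have := e.map_source h0e
    rwa [he0] at this
  have hs0 : e.symm 0 = 0 := by
    have := e.left_inv h0e
    rwa [he0] at this
  have htarget : ∀ᶠ y in 𝓝 0, y ∈ e.target := e.open_target.mem_nhds h0t
  let φ : E → ℝ := fun y => ψ (projAlong ν n (e.symm y))
  have hφ : ∀ y ∈ e.target, ContDiffAt ℝ ∞ φ y := fun y hy => by
    have h1 := (hesource _ (e.map_target hy)).2.2.2
    exact h1.comp y ((projAlong ν n).contDiff.contDiffAt.comp y (hetarget y hy))
  have hdφ : ∀ y ∈ e.target, fderiv ℝ φ y = Ξ (e.symm y) := fun y hy => by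
    obtain ⟨hx1, hx2, -, hx3⟩ := hesource _ (e.map_target hy)
    have hs := ((hetarget y hy).differentiableAt (by simp)).hasFDerivAt
    have h1 : HasFDerivAt (fun y => projAlong ν n (e.symm y)) _ y :=
      (projAlong ν n).hasFDerivAt.comp y hs
    have h2 : HasFDerivAt φ _ y :=
      HasFDerivAt.comp (g := ψ) y (hx3.differentiableAt (by simp)).hasFDerivAt h1
    have h3 : HasFDerivAt (fun y => Ψ (e.symm y)) _ y :=
      HasFDerivAt.comp y (hx1.differentiableAt (by simp)).hasFDerivAt hs
    have h4 : HasFDerivAt (fun y => Ψ (e.symm y)) (ContinuousLinearMap.id ℝ E) y := by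
      refine (hasFDerivAt_id y).congr_of_eventuallyEq ?_
      filter_upwards [e.open_target.mem_nhds hy] with z hz
      rw [← he]
      exact e.right_inv hz
    ext v
    have h5 : fderiv ℝ Ψ (e.symm y) (fderiv ℝ e.symm y v) = v :=
      congrArg (fun l => l v) (h3.unique h4)
    rw [h2.fderiv]
    have h6 := hx2 (fderiv ℝ e.symm y v)
    rw [h5] at h6
    exact h6.symm
  refine ⟨φ, ?_, ?_, ?_, ?_⟩
  · filter_upwards [htarget] with y hy using hφ y hy
  · rw [hdφ 0 h0t, hs0, hΞ0]
  · filter_upwards [hΨι, e.open_source.mem_nhds h0e] with y h1 h2 h3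
    have h4 : e.symm y = y := by
      conv_lhs => rw [← h1 h3, ← he]
      exact e.left_inv h2
    simp only [φ]
    rw [h4, projAlong_of_eq_zero h3]
  · filter_upwards [htarget] with y hy
    have h1 := (hesource _ (e.map_target hy)).2.2.1
    have h2 : Ψ (e.symm y) = y := by
      rw [← he]
      exact e.right_inv hy
    rw [hdφ y hy]
    rwa [h2] at h1

end Eikonal

/-! ### The zero set of the solution of the eikonal equation -/

section ZeroSet

set_option maxSynthPendingDepth 3

variable {E : Type*} [NormedAddCommGroup E] [NormedSpace ℝ E]

theorem strictMonoOn_line {f : E → ℝ} {x m : E} {δ : ℝ}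
    (hf : ∀ s ∈ Icc (-δ) δ, DifferentiableAt ℝ f (x + s • m) ∧ 0 < fderiv ℝ f (x + s • m) m) :
    StrictMonoOn (fun s : ℝ => f (x + s • m)) (Icc (-δ) δ) := by
  have hl : ∀ s : ℝ, HasDerivAt (fun s : ℝ => x + s • m) m s := fun s => by
    have h := ((hasDerivAt_id' s).smul_const m).const_add x
    rwa [one_smul] at h
  have hd : ∀ s ∈ Icc (-δ) δ,
      HasDerivAt (fun s : ℝ => f (x + s • m)) (fderiv ℝ f (x + s • m) m) s := fun s hs =>
    (hf s hs).1.hasFDerivAt.comp_hasDerivAt s (hl s)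
  refine strictMonoOn_of_deriv_pos (convex_Icc _ _)
    (fun s hs => (hd s hs).continuousAt.continuousWithinAt) fun s hs => ?_
  rw [(hd s (interior_subset hs)).deriv]
  exact (hf s (interior_subset hs)).2

/-- If two functions have the same nonzero differential at a common zero and one of them vanishes on
the zero set of the other, then their zero sets agree nearby. In a direction `m` in which both
functions increase, every short line segment contains a zero of `ψ`, but at most one zero
of `φ`. -/
theorem eventually_eq_zero_of_forall_zero_imp {φ ψ : E → ℝ} (hφ : SmoothNear φ 0)
    (hψ : SmoothNear ψ 0) (hψ0 : ψ 0 = 0) {m : E} (hφm : 0 < fderiv ℝ φ 0 m)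
    (hψm : 0 < fderiv ℝ ψ 0 m) (h : ∀ᶠ x in 𝓝 0, ψ x = 0 → φ x = 0) :
    ∀ᶠ x in 𝓝 0, φ x = 0 → ψ x = 0 := by
  have hpos : ∀ f : E → ℝ, SmoothNear f 0 → 0 < fderiv ℝ f 0 m →
      ∀ᶠ x in 𝓝 0, DifferentiableAt ℝ f x ∧ 0 < fderiv ℝ f x m := fun f hf hf0 =>
    hf.eventually_differentiableAt.and (continuousAt_const.eventually_lt
      (hf.smoothNear_fderiv.continuousAt.clm_apply continuousAt_const) hf0)
  obtain ⟨R, hR, hball⟩ := Metric.eventually_nhds_iff_ball.1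
    ((hpos φ hφ hφm).and ((hpos ψ hψ hψm).and h))
  obtain ⟨δ, hδ, hδR⟩ : ∃ δ : ℝ, 0 < δ ∧ δ * ‖m‖ < R / 2 := by
    refine ⟨R / 2 / (‖m‖ + 1), by positivity, ?_⟩
    rw [div_mul_eq_mul_div, div_lt_iff₀ (by positivity)]
    nlinarith
  have hmem : ∀ x ∈ Metric.ball (0 : E) (R / 2), ∀ s ∈ Icc (-δ) δ,
      x + s • m ∈ Metric.ball (0 : E) R := by
    intro x hx s hs
    rw [mem_ball_zero_iff] at hx ⊢
    have h1 : ‖s • m‖ ≤ δ * ‖m‖ := by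
      rw [norm_smul, Real.norm_eq_abs]
      exact mul_le_mul_of_nonneg_right (abs_le.2 hs) (norm_nonneg m)
    linarith [norm_add_le x (s • m)]
  have hmonoφ : ∀ x ∈ Metric.ball (0 : E) (R / 2),
      StrictMonoOn (fun s : ℝ => φ (x + s • m)) (Icc (-δ) δ) := fun x hx =>
    strictMonoOn_line fun s hs => (hball _ (hmem x hx s hs)).1
  have hmonoψ : ∀ x ∈ Metric.ball (0 : E) (R / 2),
      StrictMonoOn (fun s : ℝ => ψ (x + s • m)) (Icc (-δ) δ) := fun x hx =>
    strictMonoOn_line fun s hs => (hball _ (hmem x hx s hs)).2.1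
  have h0mem : (0 : ℝ) ∈ Icc (-δ) δ := ⟨by linarith, hδ.le⟩
  have hlmem : -δ ∈ Icc (-δ) δ := ⟨le_rfl, by linarith⟩
  have hrmem : δ ∈ Icc (-δ) δ := ⟨by linarith, le_rfl⟩
  have h0ball : (0 : E) ∈ Metric.ball (0 : E) (R / 2) := Metric.mem_ball_self (by positivity)
  have hcont : ∀ s ∈ Icc (-δ) δ, ContinuousAt (fun x => ψ (x + s • m)) 0 := by
    intro s hs
    have h1 := (hball _ (hmem 0 h0ball s hs)).2.1.1.continuousAt
    exact ContinuousAt.comp (f := fun x : E => x + s • m) h1 (by fun_prop)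
  have hright : ∀ᶠ x in 𝓝 0, 0 < ψ (x + δ • m) := by
    refine continuousAt_const.eventually_lt (hcont δ hrmem) ?_
    have := hmonoψ 0 h0ball h0mem hrmem hδ
    simpa [hψ0] using this
  have hleft : ∀ᶠ x in 𝓝 0, ψ (x + (-δ) • m) < 0 := by
    refine (hcont (-δ) hlmem).eventually_lt continuousAt_const ?_
    have := hmonoψ 0 h0ball hlmem h0mem (by linarith)
    simpa [hψ0] using this
  filter_upwards [hright, hleft, Metric.ball_mem_nhds (0 : E) (half_pos hR)] with x h1 h2 h3 hφx
  have hc : ContinuousOn (fun s : ℝ => ψ (x + s • m)) (Icc (-δ) δ) := fun s hs => by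
    have h4 := (hball _ (hmem x h3 s hs)).2.1.1.continuousAt
    exact (ContinuousAt.comp (f := fun s : ℝ => x + s • m) h4 (by fun_prop)).continuousWithinAt
  obtain ⟨s, hs, hs0⟩ := intermediate_value_Icc (by linarith) hc ⟨h2.le, h1.le⟩
  have hφs : φ (x + s • m) = 0 := (hball _ (hmem x h3 s hs)).2.2 hs0
  have hs_zero : s = 0 := (hmonoφ x h3).injOn hs h0mem (by simp [hφs, hφx])
  simpa [hs_zero] using hs0

variable [FiniteDimensional ℝ E]

/-- A solution `φ` of the eikonal equation vanishes on a characteristic surface `ψ = 0` if it does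
so on the intersection with the transversal hyperplane `ν = 0`. There is a vector field tangent to
the surface that annihilates `φ` along it, and whose integral curves reach
the hyperplane. -/
theorem eventually_eikonal_solution_eq_zero {G : E → (E →L[ℝ] ℝ) →L[ℝ] E} (hG : SmoothNear G 0)
    (hsymm : ∀ᶠ x in 𝓝 0, ∀ ξ η : E →L[ℝ] ℝ, ξ (G x η) = η (G x ξ))
    {φ ψ : E → ℝ} (hφ : SmoothNear φ 0) (hψ : SmoothNear ψ 0)
    (hφψ : fderiv ℝ φ 0 = fderiv ℝ ψ 0)
    (heik : ∀ᶠ x in 𝓝 0, fderiv ℝ φ x (G x (fderiv ℝ φ x)) = 0)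
    (hchar : ∀ᶠ x in 𝓝 0, ψ x = 0 → fderiv ℝ ψ x (G x (fderiv ℝ ψ x)) = 0)
    {ν : E →L[ℝ] ℝ} {n m : E} (hn : ν n = 1) (hnG : n = (2 : ℝ) • G 0 (fderiv ℝ ψ 0))
    (hm : fderiv ℝ ψ 0 m = 1) (hν : ∀ᶠ x in 𝓝 0, ν x = 0 → φ x = ψ x) :
    ∀ᶠ x in 𝓝 0, ψ x = 0 → φ x = 0 := by
  have : CompleteSpace E := FiniteDimensional.complete ℝ E
  -- `X` annihilates `ψ`, and takes `φ` to a multiple of the symbol at `dψ`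
  let X : E → E := fun x =>
    fderiv ℝ ψ x m • (fderiv ℝ ψ x m • G x (fderiv ℝ φ x) -
      fderiv ℝ ψ x (G x (fderiv ℝ φ x)) • m) +
    fderiv ℝ φ x m • (fderiv ℝ ψ x m • G x (fderiv ℝ ψ x) -
      fderiv ℝ ψ x (G x (fderiv ℝ ψ x)) • m)
  have hX : SmoothNear X 0 := by
    filter_upwards [hG, hφ.smoothNear_fderiv, hψ.smoothNear_fderiv] with x h1 h2 h3
    have hk := h3.clm_apply (contDiffAt_const (c := m))
    have hl := h2.clm_apply (contDiffAt_const (c := m))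
    exact (hk.smul ((hk.smul (h1.clm_apply h2)).sub
      ((h3.clm_apply (h1.clm_apply h2)).smul contDiffAt_const))).add
      (hl.smul ((hk.smul (h1.clm_apply h3)).sub
      ((h3.clm_apply (h1.clm_apply h3)).smul contDiffAt_const)))
  have hX0 : X 0 = n := by
    have h1 := heik.self_of_nhds
    rw [hφψ] at h1
    simp only [X, hφψ, hm, h1, hnG, one_smul, zero_smul, sub_zero, two_smul]
  obtain ⟨Φ, hΦ, hΦn, hΦν⟩ := exists_smoothNear_solution hX (contDiff_id.smoothNear (0 : E)) rfl hn
  simp only [id] at hΦν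
  have hΦ0 : Φ 0 = 0 := hΦν.self_of_nhds (map_zero ν)
  have hΦt : Tendsto Φ (𝓝 0) (𝓝 0) := by simpa [ContinuousAt, hΦ0] using hΦ.continuousAt
  have hΦ' : HasFDerivAt Φ (ContinuousLinearMap.id ℝ E) 0 := by
    refine hΦ.differentiableAt.hasFDerivAt.congr_fderiv ?_
    ext v
    rw [fderiv_eq_of_eq_on_hyperplane hn (map_zero ν) hΦν hΦ.differentiableAt differentiableAt_fun_id,
      hΦn.self_of_nhds, hΦ0, hX0]
    simp [projAlong_apply]
  have hcomp : ∀ f : E → ℝ, SmoothNear f 0 → ∀ᶠ x in 𝓝 0,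
      DifferentiableAt ℝ (fun x => f (Φ x)) x ∧
        fderiv ℝ (fun x => f (Φ x)) x n = fderiv ℝ f (Φ x) (X (Φ x)) := by
    intro f hf
    filter_upwards [hΦt hf.eventually_differentiableAt, hΦ.eventually_differentiableAt, hΦn]
      with x h1 h2 h3
    have h4 : HasFDerivAt (fun x => f (Φ x)) _ x := h1.hasFDerivAt.comp x h2.hasFDerivAt
    refine ⟨h4.differentiableAt, ?_⟩
    rw [h4.fderiv, ContinuousLinearMap.comp_apply, h3]
  have hψΦ : ∀ᶠ x in 𝓝 0, ψ (Φ x) = ψ (projAlong ν n x) := by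
    have h1 := eventually_eq_projAlong (ν := ν) (n := n) (f := fun x => ψ (Φ x))
      ((hcomp ψ hψ).mono fun x hx => hx.1) (by
        filter_upwards [hcomp ψ hψ] with x hx
        rw [hx.2]
        simp only [X, map_add, map_sub, map_smul, smul_eq_mul]
        ring)
    filter_upwards [h1, eventually_projAlong (ν := ν) (n := n) hΦν] with x h1 h2
    rw [h1, h2 (apply_projAlong hn x)]
  have hφΦ : ∀ᶠ x in 𝓝 0, ψ (Φ x) = 0 → DifferentiableAt ℝ (fun x => φ (Φ x)) x ∧
      fderiv ℝ (fun x => φ (Φ x)) x n = 0 := by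
    filter_upwards [hcomp φ hφ, hΦt heik, hΦt hchar, hΦt hsymm] with x h1 h2 h3 h4 h5
    refine ⟨h1.1, ?_⟩
    rw [h1.2]
    simp only [X, map_add, map_sub, map_smul, smul_eq_mul]
    rw [h2, h3 h5, h4 (fderiv ℝ φ (Φ x))]
    ring
  have hmain : ∀ᶠ x in 𝓝 0, ψ (Φ x) = 0 → φ (Φ x) = 0 := by
    filter_upwards [eventually_forall_segment_projAlong (ν := ν) (n := n) (hφΦ.and hψΦ), hψΦ,
      eventually_projAlong (ν := ν) (n := n) (hΦν.and hν)] with x h1 h2 ⟨h3, h4⟩ h5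
    have h6 := eq_projAlong_of_fderiv_eq_zero (ν := ν) (n := n) (f := fun x => φ (Φ x)) (x := x) (by
      intro z hz
      refine (h1 z hz).1 ?_
      have hπz : projAlong ν n z = projAlong ν n x := by
        rw [segment_eq_image'] at hz
        obtain ⟨s, -, rfl⟩ := hz
        simp [projAlong_apply, hn, mul_smul]
      rw [(h1 z hz).2, hπz, ← h2, h5])
    have hνx := apply_projAlong hn x
    rw [h6, h3 hνx, h4 hνx, ← h2, h5]
  obtain ⟨e, he, h0e, hesource, hetarget⟩ := hΦ.exists_openPartialHomeomorph
    (ContinuousLinearEquiv.refl ℝ E) hΦ' hmain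
  have h0t : (0 : E) ∈ e.target := by
    have := e.map_source h0e
    rwa [he, hΦ0] at this
  filter_upwards [e.open_target.mem_nhds h0t] with y hy
  have h1 := (hesource _ (e.map_target hy)).2
  have h2 : Φ (e.symm y) = y := by
    rw [← he]
    exact e.right_inv hy
  rwa [h2] at h1

/-- Every characteristic surface `ψ = 0` is locally the zero set of a solution of the eikonal
equation. -/
theorem exists_eikonal_defining_function {G : E → (E →L[ℝ] ℝ) →L[ℝ] E} (hG : SmoothNear G 0)
    (hsymm : ∀ᶠ x in 𝓝 0, ∀ ξ η : E →L[ℝ] ℝ, ξ (G x η) = η (G x ξ))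
    {ψ : E → ℝ} (hψ : SmoothNear ψ 0) (hψ0 : ψ 0 = 0)
    (hchar : ∀ᶠ x in 𝓝 0, ψ x = 0 → fderiv ℝ ψ x (G x (fderiv ℝ ψ x)) = 0)
    (hne : G 0 (fderiv ℝ ψ 0) ≠ 0) :
    ∃ φ : E → ℝ, SmoothNear φ 0 ∧ fderiv ℝ φ 0 = fderiv ℝ ψ 0 ∧
      (∀ᶠ x in 𝓝 0, fderiv ℝ φ x (G x (fderiv ℝ φ x)) = 0) ∧
      ∀ᶠ x in 𝓝 0, φ x = 0 ↔ ψ x = 0 := by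
  have hnull := hchar.self_of_nhds hψ0
  obtain ⟨ν, hν⟩ := SeparatingDual.exists_eq_one (R := ℝ) (smul_ne_zero (two_ne_zero (α := ℝ)) hne)
  obtain ⟨φ, hφ, hφψ, hφν, heik⟩ := exists_eikonal_solution hG hsymm hψ hnull hν rfl
  have hψne : fderiv ℝ ψ 0 ≠ 0 := fun h => hne (by rw [h, map_zero])
  obtain ⟨m₀, hm₀⟩ : ∃ m, fderiv ℝ ψ 0 m ≠ 0 := by
    by_contra! h
    exact hψne (ContinuousLinearMap.ext h)
  have hm : fderiv ℝ ψ 0 ((fderiv ℝ ψ 0 m₀)⁻¹ • m₀) = 1 := by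
    rw [map_smul, smul_eq_mul, inv_mul_cancel₀ hm₀]
  have h1 := eventually_eikonal_solution_eq_zero hG hsymm hφ hψ hφψ heik hchar hν rfl hm hφν
  have h2 := eventually_eq_zero_of_forall_zero_imp hφ hψ hψ0
    (by rw [hφψ, hm]; exact one_pos) (by rw [hm]; exact one_pos) h1
  refine ⟨φ, hφ, hφψ, heik, ?_⟩
  filter_upwards [h1, h2] with x h3 h4 using ⟨h4, h3⟩

end ZeroSet

/-! ### The principal symbol as a symmetric bilinear form -/

section Symbol

set_option maxSynthPendingDepth 3

namespace SecondOrderOp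

variable {𝕜 : Type*} [RCLike 𝕜]

/-- The symmetrized principal part of `P` at `x`, as a map from covectors to vectors: the symbol
is `ξ ↦ ξ (P.contravariantMetric x ξ)`. -/
noncomputable def contravariantMetric (P : SecondOrderOp 𝕜) (x : R3) : (R3 →L[ℝ] ℝ) →L[ℝ] R3 :=
  ∑ i, ∑ j, ((P.g i j x + P.g j i x) / 2) •
    (ContinuousLinearMap.apply ℝ ℝ (EuclideanSpace.single j (1 : ℝ) : R3)).smulRight
      (EuclideanSpace.single i (1 : ℝ))

theorem contravariantMetric_symm (P : SecondOrderOp 𝕜) (x : R3) (ξ η : R3 →L[ℝ] ℝ) :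
    ξ (P.contravariantMetric x η) = η (P.contravariantMetric x ξ) := by
  simp only [contravariantMetric, Fin.sum_univ_three, _root_.add_apply, _root_.smul_apply,
    ContinuousLinearMap.smulRight_apply, ContinuousLinearMap.apply_apply, map_add, map_smul,
    smul_eq_mul]
  ring

theorem symbol_eq (P : SecondOrderOp 𝕜) (x : R3) (ξ : R3 →L[ℝ] ℝ) :
    P.symbol x ξ = ξ (P.contravariantMetric x ξ) := by
  simp only [symbol, contravariantMetric, Fin.sum_univ_three, _root_.add_apply, _root_.smul_apply,
    ContinuousLinearMap.smulRight_apply, ContinuousLinearMap.apply_apply, map_add, map_smul,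
    smul_eq_mul]
  ring

theorem SmoothOn.smoothNear_contravariantMetric {P : SecondOrderOp 𝕜} {Ω : Set R3}
    (hP : P.SmoothOn Ω) (hΩ : IsOpen Ω) {x : R3} (hx : x ∈ Ω) :
    SmoothNear P.contravariantMetric x := by
  filter_upwards [hΩ.mem_nhds hx] with y hy
  have hg : ∀ i j, ContDiffAt ℝ ∞ (P.g i j) y := fun i j =>
    (hP.1 i j).contDiffAt (hΩ.mem_nhds hy)
  exact ContDiffAt.sum fun i _ => ContDiffAt.sum fun j _ =>
    (((hg i j).add (hg j i)).div_const 2).smul contDiffAt_const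

/-- In the strictly hyperbolic case a nonzero null covector is not in the radical of the symbol:
otherwise the two roots in the direction of the time function would coincide. -/
theorem StrictlyHyperbolicOn.contravariantMetric_ne_zero {P : SecondOrderOp 𝕜} {Ω : Set R3}
    {t : R3 → ℝ} (h : P.StrictlyHyperbolicOn Ω t) {x : R3} (hx : x ∈ Ω) {ξ : R3 →L[ℝ] ℝ}
    (hξ : ξ ≠ 0) (hnull : P.symbol x ξ = 0) : P.contravariantMetric x ξ ≠ 0 := by
  intro h0
  obtain ⟨ht, hroots⟩ := h x hx
  obtain ⟨τ₁, τ₂, hne, h1, h2⟩ := hroots ξ (by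
    rintro ⟨r, rfl⟩
    rw [symbol_eq, map_smul, map_smul, _root_.smul_apply, ← symbol_eq, smul_eq_mul,
      smul_eq_mul] at hnull
    have hr : r = 0 := by simpa [ht] using hnull
    exact hξ (by rw [hr, zero_smul]))
  have hexp : ∀ τ : ℝ, P.symbol x (ξ + τ • fderiv ℝ t x) = τ ^ 2 * P.symbol x (fderiv ℝ t x) := by
    intro τ
    rw [symbol_eq, symbol_eq, map_add, h0, zero_add, map_smul, _root_.add_apply, map_smul,
      contravariantMetric_symm P x ξ, h0, map_zero, _root_.smul_apply, map_smul, smul_eq_mul,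
      smul_eq_mul]
    simp only [smul_eq_mul]
    ring
  rw [hexp] at h1 h2
  have h3 : τ₁ = 0 := by simpa [ht] using h1
  have h4 : τ₂ = 0 := by simpa [ht] using h2
  exact hne (h3.trans h4.symm)

end SecondOrderOp

end Symbol

/-! ### Change of variables in the operator -/

section ChangeOfVariables

theorem fderiv_eq_sum_pd {F : Type*} [NormedAddCommGroup F] [NormedSpace ℝ F] (u : R3 → F)
    (x v : R3) : fderiv ℝ u x v = ∑ k, v k • pd k u x := by
  conv_lhs => rw [← (EuclideanSpace.basisFun (Fin 3) ℝ).sum_repr v]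
  simp [pd, map_sum]

theorem ContDiffAt.pd {F : Type*} [NormedAddCommGroup F] [NormedSpace ℝ F] {u : R3 → F}
    {x : R3} {m n : WithTop ℕ∞} (h : ContDiffAt ℝ n u x) (hmn : m + 1 ≤ n) (i : Fin 3) :
    ContDiffAt ℝ m (pd i u) x :=
  (h.fderiv_right hmn).clm_apply contDiffAt_const

/-- Chain rule for partial derivatives. -/
theorem pd_comp {F : Type*} [NormedAddCommGroup F] [NormedSpace ℝ F] {w : R3 → F}
    {Y : R3 → R3} {x : R3} (hw : DifferentiableAt ℝ w (Y x)) (hY : DifferentiableAt ℝ Y x)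
    (i : Fin 3) :
    pd i (fun z => w (Y z)) x = ∑ k, pd i (fun z => Y z k) x • pd k w (Y x) := by
  have h1 : HasFDerivAt (fun z => w (Y z)) _ x := hw.hasFDerivAt.comp x hY.hasFDerivAt
  have h2 : ∀ k, pd i (fun z => Y z k) x = fderiv ℝ Y x (EuclideanSpace.single i 1) k := by
    intro k
    have h3 : HasFDerivAt (fun z => Y z k) _ x :=
      (EuclideanSpace.proj (𝕜 := ℝ) k).hasFDerivAt.comp x hY.hasFDerivAt
    rw [_root_.pd, h3.fderiv]
    rfl
  rw [_root_.pd, h1.fderiv, ContinuousLinearMap.comp_apply, fderiv_eq_sum_pd]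
  simp only [h2]

theorem pd_pd_comp {F : Type*} [NormedAddCommGroup F] [NormedSpace ℝ F] {w : R3 → F}
    {Y : R3 → R3} {x : R3} (hw : ContDiffAt ℝ 2 w (Y x)) (hY : ContDiffAt ℝ 2 Y x)
    (i j : Fin 3) :
    pd i (pd j (fun z => w (Y z))) x =
      ∑ k, (pd i (pd j (fun z => Y z k)) x • pd k w (Y x) +
        pd j (fun z => Y z k) x • ∑ l, pd i (fun z => Y z l) x • pd l (pd k w) (Y x)) := by
  have h1 : pd j (fun z => w (Y z)) =ᶠ[𝓝 x]
      fun z => ∑ k, pd j (fun z => Y z k) z • pd k w (Y z) := by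
    filter_upwards [hY.continuousAt.eventually (hw.eventually (by simp)), hY.eventually (by simp)]
      with z h2 h3
    exact pd_comp (h2.differentiableAt (by simp)) (h3.differentiableAt (by simp)) j
  have hYk : ∀ k, DifferentiableAt ℝ (pd j (fun z => Y z k)) x := fun k =>
    (((EuclideanSpace.proj (𝕜 := ℝ) k).contDiff.contDiffAt.comp x hY).pd
      (m := 1) (by norm_num) j).differentiableAt (by simp)
  have hwk : ∀ k, DifferentiableAt ℝ (pd k w) (Y x) := fun k =>
    (hw.pd (m := 1) (by norm_num) k).differentiableAt (by simp)
  have hYd : DifferentiableAt ℝ Y x := hY.differentiableAt (by simp)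
  have hwY : ∀ k, DifferentiableAt ℝ (fun z => pd k w (Y z)) x := fun k => (hwk k).comp x hYd
  have h4 : HasFDerivAt (fun z => ∑ k, pd j (fun z => Y z k) z • pd k w (Y z)) _ x :=
    HasFDerivAt.fun_sum (u := Finset.univ) fun k _ =>
      (hYk k).hasFDerivAt.smul (hwY k).hasFDerivAt
  rw [_root_.pd, h1.fderiv_eq, h4.fderiv, _root_.sum_apply]
  refine Finset.sum_congr rfl fun k _ => ?_
  rw [← pd_comp (hwk k) hYd i]
  simp [_root_.pd, add_comm]

theorem pd_pd_comm {F : Type*} [NormedAddCommGroup F] [NormedSpace ℝ F] {w : R3 → F} {y : R3}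
    (hw : ContDiffAt ℝ 2 w y) (k l : Fin 3) : pd k (pd l w) y = pd l (pd k w) y := by
  have hd : DifferentiableAt ℝ (fderiv ℝ w) y :=
    (hw.fderiv_right (m := 1) (by norm_num)).differentiableAt (by simp)
  have h : ∀ a b : Fin 3, pd a (pd b w) y =
      fderiv ℝ (fderiv ℝ w) y (EuclideanSpace.single a 1) (EuclideanSpace.single b 1) := by
    intro a b
    have h1 : HasFDerivAt (pd b w) _ y :=
      hd.hasFDerivAt.clm_apply (hasFDerivAt_const (EuclideanSpace.single b (1 : ℝ)) y)
    rw [_root_.pd, h1.fderiv]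
    simp
  rw [h, h]
  exact (hw.isSymmSndFDerivAt (by simp)).eq _ _

variable {𝕜 : Type*} [RCLike 𝕜]

/-- The coefficient of `∂ₖ∂ₗ` of the operator `P` in the coordinates `Y`, as a function of the
original variables. -/
noncomputable def SecondOrderOp.principalIn (P : SecondOrderOp 𝕜) (Y : R3 → R3) (k l : Fin 3)
    (x : R3) : ℝ :=
  ∑ i, ∑ j, P.g i j x * pd i (fun z => Y z k) x * pd j (fun z => Y z l) x

/-- The coefficient of `∂ₖ` of the operator `P` in the coordinates `Y`, as a function of the
original variables. -/
noncomputable def SecondOrderOp.firstOrderIn (P : SecondOrderOp 𝕜) (Y : R3 → R3) (k : Fin 3)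
    (x : R3) : 𝕜 :=
  ((∑ i, ∑ j, P.g i j x * pd i (pd j (fun z => Y z k)) x : ℝ) : 𝕜) +
    ∑ i, P.lower.b i x * ((pd i (fun z => Y z k) x : ℝ) : 𝕜)

theorem SecondOrderOp.principalIn_self (P : SecondOrderOp 𝕜) (Y : R3 → R3) (k : Fin 3) (x : R3) :
    P.principalIn Y k k x = P.symbol x (fderiv ℝ (fun z => Y z k) x) := rfl

theorem SecondOrderOp.apply_comp (P : SecondOrderOp 𝕜) {Y : R3 → R3} {x : R3} {v : R3 → 𝕜}
    (hv : ContDiffAt ℝ 2 v (Y x)) (hY : ContDiffAt ℝ 2 Y x) :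
    P.apply (fun z => v (Y z)) x =
      ∑ k, ∑ l, P.principalIn Y k l x • pd k (pd l v) (Y x) +
        (∑ k, P.firstOrderIn Y k x * pd k v (Y x) + P.lower.c x * v (Y x)) := by
  have h1 := hv.differentiableAt (by simp)
  have h2 := hY.differentiableAt (by simp)
  simp only [SecondOrderOp.apply, FirstOrderOp.apply, pd_pd_comp hv hY, pd_comp h1 h2,
    SecondOrderOp.principalIn, SecondOrderOp.firstOrderIn, Fin.sum_univ_three,
    RCLike.real_smul_eq_coe_mul, map_add, map_mul]
  ring

theorem SecondOrderOp.SmoothOn.contDiffAt_principalIn {P : SecondOrderOp 𝕜} {Ω : Set R3}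
    (hP : P.SmoothOn Ω) (hΩ : IsOpen Ω) {Y : R3 → R3} {x : R3} (hx : x ∈ Ω)
    (hY : ContDiffAt ℝ ∞ Y x) (k l : Fin 3) : ContDiffAt ℝ ∞ (P.principalIn Y k l) x := by
  have hYk : ∀ k, ContDiffAt ℝ ∞ (fun z => Y z k) x := fun k =>
    (EuclideanSpace.proj (𝕜 := ℝ) k).contDiff.contDiffAt.comp x hY
  exact ContDiffAt.sum fun i _ => ContDiffAt.sum fun j _ =>
    (((hP.1 i j).contDiffAt (hΩ.mem_nhds hx)).mul ((hYk k).pd (by simp) i)).mul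
      ((hYk l).pd (by simp) j)

theorem SecondOrderOp.SmoothOn.contDiffAt_firstOrderIn {P : SecondOrderOp 𝕜} {Ω : Set R3}
    (hP : P.SmoothOn Ω) (hΩ : IsOpen Ω) {Y : R3 → R3} {x : R3} (hx : x ∈ Ω)
    (hY : ContDiffAt ℝ ∞ Y x) (k : Fin 3) : ContDiffAt ℝ ∞ (P.firstOrderIn Y k) x := by
  have hYk : ContDiffAt ℝ ∞ (fun z => Y z k) x :=
    (EuclideanSpace.proj (𝕜 := ℝ) k).contDiff.contDiffAt.comp x hY
  have hcoe : ContDiff ℝ ∞ ((↑) : ℝ → 𝕜) := (RCLike.ofRealCLM (K := 𝕜)).contDiff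
  refine ContDiffAt.add (hcoe.contDiffAt.comp x ?_) (ContDiffAt.sum fun i _ => ?_)
  · exact ContDiffAt.sum fun i _ => ContDiffAt.sum fun j _ =>
      ((hP.1 i j).contDiffAt (hΩ.mem_nhds hx)).mul
        ((hYk.pd (m := ∞) (by simp) j).pd (by simp) i)
  · exact ((hP.2.1 i).contDiffAt (hΩ.mem_nhds hx)).mul
      (hcoe.contDiffAt.comp x (hYk.pd (by simp) i))

end ChangeOfVariables

/-! ### Coordinates with prescribed characteristic coordinate surfaces -/

section Coordinates

/-- Linearly independent covectors on `ℝ³` are the coordinates of a linear automorphism. -/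
theorem exists_continuousLinearEquiv_of_linearIndependent {ξ : Fin 3 → R3 →L[ℝ] ℝ}
    (hξ : LinearIndependent ℝ ξ) : ∃ T : R3 ≃L[ℝ] R3, ∀ v j, T v j = ξ j v := by
  let T₀ : R3 →ₗ[ℝ] R3 :=
    { toFun := fun v => WithLp.toLp 2 fun j => ξ j v
      map_add' := fun v w => by ext j; simp
      map_smul' := fun c v => by ext j; simp }
  have hfin : Module.finrank ℝ (R3 →L[ℝ] ℝ) = 3 := by
    rw [← (LinearMap.toContinuousLinearMap (𝕜 := ℝ) (E := R3) (F' := ℝ)).finrank_eq]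
    simp
  have : FiniteDimensional ℝ (R3 →L[ℝ] ℝ) := .of_finrank_pos (by omega)
  have hspan := hξ.span_eq_top_of_card_eq_finrank (by simp [hfin])
  have hinj : Function.Injective T₀ := by
    rw [← LinearMap.ker_eq_bot, LinearMap.ker_eq_bot']
    intro v hv
    have h0 : ∀ η : R3 →L[ℝ] ℝ, η v = 0 := by
      intro η
      have hη : η ∈ Submodule.span ℝ (range ξ) := hspan ▸ Submodule.mem_top
      induction hη using Submodule.span_induction with
      | mem η h =>
        obtain ⟨j, rfl⟩ := h
        exact congrArg (fun w : R3 => w j) hv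
      | zero => rfl
      | add a b _ _ ha hb => rw [_root_.add_apply, ha, hb, add_zero]
      | smul c a _ ha => rw [_root_.smul_apply, ha, smul_zero]
    exact SeparatingDual.eq_zero_of_forall_dual_eq_zero (R := ℝ) h0
  exact ⟨(LinearEquiv.ofInjectiveEndo T₀ hinj).toContinuousLinearEquiv, fun v j => rfl⟩

end Coordinates

/-! ### Characteristic hypersurfaces as coordinate surfaces -/

/-- A closed characteristic hypersurface of a strictly hyperbolic operator is, near the origin, the
zero set of a solution of the eikonal equation, whose differential at the origin is a normal
covector. -/
theorem IsClosedHypersurface.exists_eikonal_coordinate {𝕜 : Type*} [RCLike 𝕜] {Ω : Set R3}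
    (hΩ : IsOpen Ω) (h0 : (0 : R3) ∈ Ω) {P : SecondOrderOp 𝕜} (hP : P.SmoothOn Ω) {t : R3 → ℝ}
    (hyp : P.StrictlyHyperbolicOn Ω t) {S : Set R3} (hS : IsClosedHypersurface Ω S)
    (hchar : IsCharacteristic P S) (h0S : (0 : R3) ∈ S) :
    ∃ φ : R3 → ℝ, SmoothNear φ 0 ∧ IsNormalCovector S 0 (fderiv ℝ φ 0) ∧
      (∀ᶠ x in 𝓝 0, P.symbol x (fderiv ℝ φ x) = 0) ∧ ∀ᶠ x in 𝓝 0, x ∈ S ↔ φ x = 0 := by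
  obtain ⟨U, ψ, h0U, hψ⟩ := hS.exists_defining 0 h0S
  have hU : ∀ᶠ x in 𝓝 0, x ∈ U := hψ.isOpen.mem_nhds h0U
  have hnormal : ∀ x ∈ U, IsNormalCovector S x (fderiv ℝ ψ x) := fun x hx => ⟨U, ψ, hx, hψ, rfl⟩
  obtain ⟨φ, hφ, hφψ, heik, hzero⟩ := exists_eikonal_defining_function
    (hP.smoothNear_contravariantMetric hΩ h0)
    (Eventually.of_forall fun x ξ η => P.contravariantMetric_symm x ξ η)
    (hψ.smooth.smoothNear hψ.isOpen h0U) ((hψ.mem_iff 0 h0U).1 h0S) (by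
      filter_upwards [hU] with x hx hx0
      rw [← P.symbol_eq]
      exact hchar x ((hψ.mem_iff x hx).2 hx0) _ (hnormal x hx))
    (hyp.contravariantMetric_ne_zero h0 (hψ.fderiv_ne_zero 0 h0U)
      (hchar 0 h0S _ (hnormal 0 h0U)))
  refine ⟨φ, hφ, hφψ ▸ hnormal 0 h0U, ?_, ?_⟩
  · filter_upwards [heik] with x hx
    rwa [P.symbol_eq]
  · filter_upwards [hzero, hU] with x hx hxU
    rw [hψ.mem_iff x hxU, hx]

theorem OpenPartialHomeomorph.contDiffOn_comp_symm {E F : Type*} [NormedAddCommGroup E]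
    [NormedSpace ℝ E] [NormedAddCommGroup F] [NormedSpace ℝ F] (e : OpenPartialHomeomorph E E)
    (he : ∀ y ∈ e.target, ContDiffAt ℝ ∞ e.symm y) {f : E → F}
    (hf : ∀ x ∈ e.source, ContDiffAt ℝ ∞ f x) :
    ContDiffOn ℝ ∞ (fun y => f (e.symm y)) e.target :=
  fun y hy => ((hf _ (e.map_target hy)).comp y (he y hy)).contDiffWithinAt

theorem proposition2p8 {𝕜 : Type*} [RCLike 𝕜]
    (Ω : Set R3) (hΩ : IsOpen Ω) (h0 : (0 : R3) ∈ Ω)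
    (P : SecondOrderOp 𝕜) (hP : P.SmoothOn Ω)
    (t : R3 → ℝ) (ht : ContDiffOn ℝ ∞ t Ω) (hyp : P.StrictlyHyperbolicOn Ω t)
    (S : Fin 3 → Set R3) (hS : ∀ j, IsClosedHypersurface Ω (S j))
    (hchar : ∀ j, IsCharacteristic P (S j))
    (hinter : (⋂ j, S j) = {0})
    (hnormal : ∀ ξ : Fin 3 → (R3 →L[ℝ] ℝ),
      (∀ j, IsNormalCovector (S j) 0 (ξ j)) → LinearIndependent ℝ ξ) :
    ∃ Y : OpenPartialHomeomorph R3 R3,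
      (0 : R3) ∈ Y.source ∧ Y.source ⊆ Ω ∧
      ContDiffOn ℝ ∞ Y Y.source ∧ ContDiffOn ℝ ∞ Y.symm Y.target ∧
      (∀ j, ∀ x ∈ Y.source, x ∈ S j ↔ Y x j = 0) ∧
      ∃ (a₁₂ a₁₃ a₂₃ : R3 → ℝ) (L : FirstOrderOp 𝕜),
        ContDiffOn ℝ ∞ a₁₂ Y.target ∧ ContDiffOn ℝ ∞ a₁₃ Y.target ∧
        ContDiffOn ℝ ∞ a₂₃ Y.target ∧ L.SmoothOn Y.target ∧
        ∀ v : R3 → 𝕜, ContDiffOn ℝ 2 v Y.target → ∀ x ∈ Y.source,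
          P.apply (fun z => v (Y z)) x =
            a₁₂ (Y x) • pd 0 (pd 1 v) (Y x) + a₁₃ (Y x) • pd 0 (pd 2 v) (Y x) +
              a₂₃ (Y x) • pd 1 (pd 2 v) (Y x) + L.apply v (Y x) := by
  have h0S : ∀ j, (0 : R3) ∈ S j := fun j =>
    mem_iInter.1 (hinter ▸ mem_singleton (0 : R3) : (0 : R3) ∈ ⋂ j, S j) j
  choose φ hφ hφn hφeik hφS using fun j =>
    (hS j).exists_eikonal_coordinate hΩ h0 hP hyp (hchar j) (h0S j)
  let F : R3 → R3 := fun x => WithLp.toLp 2 fun j => φ j x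
  have hF : SmoothNear F 0 := by
    filter_upwards [eventually_all.2 hφ] with x hx
    exact contDiffAt_euclidean.2 hx
  obtain ⟨T, hT⟩ := exists_continuousLinearEquiv_of_linearIndependent (hnormal _ hφn)
  have hF' : HasFDerivAt F (T : R3 →L[ℝ] R3) 0 := by
    refine hF.differentiableAt.hasFDerivAt.congr_fderiv ?_
    ext v j
    have h1 : HasFDerivAt (fun x => F x j) _ 0 :=
      (EuclideanSpace.proj (𝕜 := ℝ) j).hasFDerivAt.comp 0 hF.differentiableAt.hasFDerivAt
    have h2 := congrArg (fun l => l v) (h1.unique (hφ j).differentiableAt.hasFDerivAt)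
    exact h2.trans (hT v j).symm
  have hΩ' : ∀ᶠ x in 𝓝 (0 : R3), x ∈ Ω := hΩ.mem_nhds h0
  obtain ⟨Y, hYF, h0Y, hsource, htarget⟩ := hF.exists_openPartialHomeomorph T hF'
    (hΩ'.and ((eventually_all.2 hφeik).and (eventually_all.2 hφS)))
  have hpull : ∀ k l, ContDiffOn ℝ ∞ (fun y => P.principalIn F k l (Y.symm y)) Y.target :=
    fun k l => Y.contDiffOn_comp_symm htarget fun x hx =>
      hP.contDiffAt_principalIn hΩ (hsource x hx).2.1 (hsource x hx).1 k l
  refine ⟨Y, h0Y, fun x hx => (hsource x hx).2.1, ?_, ?_, ?_,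
    fun y => P.principalIn F 0 1 (Y.symm y) + P.principalIn F 1 0 (Y.symm y),
    fun y => P.principalIn F 0 2 (Y.symm y) + P.principalIn F 2 0 (Y.symm y),
    fun y => P.principalIn F 1 2 (Y.symm y) + P.principalIn F 2 1 (Y.symm y),
    ⟨fun k y => P.firstOrderIn F k (Y.symm y), fun y => P.lower.c (Y.symm y)⟩,
    (hpull 0 1).add (hpull 1 0), (hpull 0 2).add (hpull 2 0), (hpull 1 2).add (hpull 2 1),
    ⟨fun k => Y.contDiffOn_comp_symm htarget (f := P.firstOrderIn F k) fun x hx => ?_,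
      Y.contDiffOn_comp_symm htarget (f := P.lower.c) fun x hx => ?_⟩, ?_⟩
  · rw [hYF]
    exact fun x hx => (hsource x hx).1.contDiffWithinAt
  · exact fun y hy => (htarget y hy).contDiffWithinAt
  · intro j x hx
    rw [hYF]
    exact (hsource x hx).2.2.2 j
  · exact hP.contDiffAt_firstOrderIn hΩ (hsource x hx).2.1 (hsource x hx).1 k
  · exact hP.2.2.contDiffAt (hΩ.mem_nhds (hsource x hx).2.1)
  · intro v hv x hx
    obtain ⟨hFx, -, heik, -⟩ := hsource x hx
    have hvx : ContDiffAt ℝ 2 v (Y x) :=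
      hv.contDiffAt (Y.open_target.mem_nhds (Y.map_source hx))
    have hYx : ContDiffAt ℝ 2 Y x := by
      rw [hYF]
      exact hFx.of_le (by simpa using ENat.LEInfty.out)
    -- the coordinate functions solve the eikonal equation, so the diagonal coefficients vanish
    have hdiag : ∀ k, P.principalIn F k k x = 0 := fun k =>
      (P.principalIn_self F k x).trans (heik k)
    rw [P.apply_comp hvx hYx, hYF]
    rw [hYF] at hvx
    simp only [FirstOrderOp.apply, Fin.sum_univ_three, ← hYF, Y.left_inv hx]
    simp only [hYF, hdiag, pd_pd_comm hvx 1 0, pd_pd_comm hvx 2 0, pd_pd_comm hvx 2 1, zero_smul,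
      add_smul]
    ring
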